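/- \textbf{Conventions.} The spaces $X$, $X'$, $X''$, $Y$ are based, locally compact, Hausdorff and well-pointed (the inclusion of the base point has the homotopy extension property); mapping spaces carry the compact-open topology. $\mathrm{map}(X,Y)$ denotes the component of the constant map at the base point $y_0$ in the space of all unbased maps $X\to Y$, i.e. the space of maps freely homotopic to that constant map, based at the constant map. For a based space $(Z,z)$ let $\mathrm{aut}_1 Z$ be the space of self-maps of $Z$ freely homotopic to $\mathrm{id}_Z$; for $n\ge 1$ the Gottlieb group $G_n(Z)\subseteq\pi_n(Z,z)$ is the image of the homomorphism $\pi_n(\mathrm{aut}_1 Z,\mathrm{id}_Z)\to\pi_n(Z,z)$ induced by the evaluation $f\mapsto f(z)$. $\Sigma$ is the reduced suspension, and $\simeq$ is based homotopy equivalence. \textbf{Theorem.} Let $Y$ be path-connected and let $n\ge 1$. (1) Let $X$ be connected with, for some integers $k\ge 0$ and $i_1,\dots,i_k\ge 0$ (the empty wedge being a point), $\Sigma X\simeq S^{i_1+1}\vee\cdots\vee S^{i_k+1}$. Then there is an isomorphism of groups $$G_n(\mathrm{map}(X,Y))\cong G_n(Y)\oplus\bigoplus_{r=1}^{k}G_{n+i_r}(Y).$$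 (2) More generally, let $X=X'\times X''$ with $X'$ and $X''$ connected and, for such $k$ and $i_r$, $\Sigma X'\simeq S^{i_1+1}\vee\cdots\vee S^{i_k+1}$. Then there is an isomorphism of groups $$G_n(\mathrm{map}(X,Y))\cong G_n(\mathrm{map}(X'',Y))\oplus\bigoplus_{r=1}^{k}G_{n+i_r}(\mathrm{map}(X'',Y)).$$ (3) In particular, for $X=S^1$ and $\Lambda Y=\mathrm{map}(S^1,Y)$ there is an isomorphism of groups $$G_n(\Lambda Y)\cong G_n(Y)\oplus G_{n+1}(Y).$$ -/

import Mathlib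

open scoped unitInterval Topology Topology.Homotopy

namespace Gottlieb

universe u v w

/-! ### Homotopy groups: the homomorphism induced by a based map -/

/-- Composition of an `N`-dimensional loop in `X` at `x` with a map `f : X → Y` such that
`f x = y`. -/
def mapGenLoop {N : Type w} {X : Type u} {Y : Type v} [TopologicalSpace X] [TopologicalSpace Y]
    {x : X} {y : Y} (f : C(X, Y)) (hf : f x = y) (p : Ω^ N X x) : Ω^ N Y y :=
  ⟨f.comp p.1, fun t ht => (congrArg f (p.2 t ht)).trans hf⟩

/-- The homomorphism `f_# : π_N(X, x) → π_N(Y, y)` induced by a map `f : X → Y` with `f x = y`. -/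
noncomputable def inducedHom (N : Type w) [DecidableEq N] [Nonempty N] {X : Type u} {Y : Type v}
    [TopologicalSpace X] [TopologicalSpace Y] {x : X} {y : Y} (f : C(X, Y)) (hf : f x = y) :
    HomotopyGroup N X x →* HomotopyGroup N Y y :=
  MonoidHom.mk'
    (Quotient.map (mapGenLoop f hf) fun _ _ h => h.map fun H => H.compContinuousMap f)
    (by
      rintro ⟨p⟩ ⟨q⟩
      have h1 := HomotopyGroup.mul_spec (i := Classical.arbitrary N) (p := p) (q := q)
      have h2 := HomotopyGroup.mul_spec (i := Classical.arbitrary N)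
        (p := mapGenLoop f hf p) (q := mapGenLoop f hf q)
      refine (congrArg _ h1).trans (Eq.trans ?_ h2.symm)
      refine congrArg (Quotient.mk _) (GenLoop.ext _ _ fun t => ?_)
      change f (GenLoop.transAt _ q p t) = GenLoop.transAt _ _ _ t
      simp only [GenLoop.transAt, GenLoop.coe_copy]
      split_ifs <;> rfl)

/-! ### Spaces of maps and Gottlieb groups -/

/-- `aut₁ Z`: the self-maps of `Z` freely homotopic to the identity, with the compact-open
topology. -/
abbrev Aut₁ (Z : Type u) [TopologicalSpace Z] : Type u :=
  {f : C(Z, Z) // f.Homotopic (ContinuousMap.id Z)}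

/-- The identity, as the base point of `aut₁ Z`. -/
def Aut₁.one (Z : Type u) [TopologicalSpace Z] : Aut₁ Z :=
  ⟨ContinuousMap.id Z, ContinuousMap.Homotopic.refl _⟩

/-- The evaluation map `ω : aut₁ Z → Z`, `f ↦ f z`. -/
def evalMap {Z : Type u} [TopologicalSpace Z] (z : Z) : C(Aut₁ Z, Z) where
  toFun f := f.1 z
  continuous_toFun := (continuous_eval_const z).comp continuous_subtype_val

/-- The `n`-th Gottlieb group of `(Z, z)`, `n ≥ 1`: the image of
`ω_# : π_n(aut₁ Z, id) → π_n(Z, z)`. -/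
noncomputable def gottliebGroup (n : ℕ) [NeZero n] (Z : Type u) [TopologicalSpace Z] (z : Z) :
    Subgroup (π_ n Z z) :=
  (inducedHom (Fin n) (x := Aut₁.one Z) (evalMap z) rfl).range

/-- `map(X, Y; 0)`: the maps `X → Y` freely homotopic to the constant map at `y₀`, with the
compact-open topology. If `X` is locally compact, this is the path component of that constant map
in the space of all maps. -/
abbrev NullMap (X : Type u) {Y : Type v} [TopologicalSpace X] [TopologicalSpace Y] (y₀ : Y) :
    Type (max u v) :=
  {f : C(X, Y) // f.Homotopic (ContinuousMap.const X y₀)}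

/-- The constant map at `y₀`, as the base point of `map(X, Y; 0)`. -/
def NullMap.base (X : Type u) {Y : Type v} [TopologicalSpace X] [TopologicalSpace Y] (y₀ : Y) :
    NullMap X y₀ :=
  ⟨ContinuousMap.const X y₀, ContinuousMap.Homotopic.refl _⟩

/-! ### Based spaces -/

/-- `(X, x₀)` is well-pointed: the inclusion of `x₀` has the homotopy extension property (test
spaces in the universe of `X` suffice, as the universal one is a subset of `X × I`). -/
def WellPointed {X : Type u} [TopologicalSpace X] (x₀ : X) : Prop :=
  ∀ (Z : Type u) [TopologicalSpace Z] (f : C(X, Z)) (h : C(I, Z)), h 0 = f x₀ →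
    ∃ F : C(X × I, Z), (∀ x, F (x, 0) = f x) ∧ ∀ t, F (x₀, t) = h t

/-- Based homotopy equivalence of the based spaces `(A, a)` and `(B, b)`. -/
def BasedHomotopyEquiv {A : Type u} {B : Type v} [TopologicalSpace A] [TopologicalSpace B]
    (a : A) (b : B) : Prop :=
  ∃ (f : C(A, B)) (g : C(B, A)), f a = b ∧ g b = a ∧
    (g.comp f).HomotopicRel (ContinuousMap.id A) {a} ∧
    (f.comp g).HomotopicRel (ContinuousMap.id B) {b}

/-- The equivalence relation on `T` that identifies all points of `S` with each other. -/
def collapseSetoid {T : Type u} (S : Set T) : Setoid T where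
  r p q := p = q ∨ (p ∈ S ∧ q ∈ S)
  iseqv :=
    { refl := fun _ => Or.inl rfl
      symm := by
        rintro p q (rfl | ⟨hp, hq⟩)
        · exact Or.inl rfl
        · exact Or.inr ⟨hq, hp⟩
      trans := by
        rintro p q r (rfl | ⟨hp, hq⟩) (rfl | ⟨hq', hr⟩)
        · exact Or.inl rfl
        · exact Or.inr ⟨hq', hr⟩
        · exact Or.inr ⟨hp, hq⟩
        · exact Or.inr ⟨hp, hr⟩ }

/-- The quotient space `T / S`. -/
abbrev Collapse {T : Type u} [TopologicalSpace T] (S : Set T) : Type u :=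
  Quotient (collapseSetoid S)

/-- The reduced suspension `ΣX = (X × I) / (X × {0} ∪ X × {1} ∪ {x₀} × I)`. -/
abbrev Suspension {X : Type u} [TopologicalSpace X] (x₀ : X) : Type u :=
  Collapse {p : X × I | p.1 = x₀ ∨ p.2 = 0 ∨ p.2 = 1}

/-- The base point of `ΣX`. -/
def Suspension.base {X : Type u} [TopologicalSpace X] (x₀ : X) : Suspension x₀ :=
  Quotient.mk _ (x₀, 0)

/-- The wedge of a family of based spaces: the quotient of the disjoint union of a point and the
members of the family that identifies all base points with the point. -/
abbrev Wedge {ι : Type u} {S : ι → Type v} [∀ r, TopologicalSpace (S r)] (s : ∀ r, S r) :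
    Type (max u v) :=
  Collapse (T := Unit ⊕ Σ r, S r) (insert (Sum.inl ()) (Set.range fun r => Sum.inr ⟨r, s r⟩))

/-- The base point of a wedge. -/
def Wedge.base {ι : Type u} {S : ι → Type v} [∀ r, TopologicalSpace (S r)] (s : ∀ r, S r) :
    Wedge s :=
  Quotient.mk _ (Sum.inl ())

/-- The sphere `S^m`, the unit sphere of `ℝ^(m+1)`. -/
abbrev Sphere (m : ℕ) : Type :=
  Metric.sphere (0 : EuclideanSpace ℝ (Fin (m + 1))) 1

/-- The base point `(1, 0, …, 0)` of `S^m`. -/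
noncomputable def Sphere.base (m : ℕ) : Sphere m :=
  ⟨EuclideanSpace.single 0 1, by simp⟩

/-- `(A, a)` splits as `S^{i₁+1} ∨ ⋯ ∨ S^{i_k+1}`, up to based homotopy equivalence. -/
def SplitsAsSpheres {A : Type u} [TopologicalSpace A] (a : A) {k : ℕ} (i : Fin k → ℕ) : Prop :=
  BasedHomotopyEquiv a (Wedge.base fun r => Sphere.base (i r + 1))

end Gottlieb

namespace Gottlieb

universe u v w

/-! ### Generalised loops and their homotopies -/

section Loops

variable {N : Type*} {X Y Z : Type*} [TopologicalSpace X] [TopologicalSpace Y] [TopologicalSpace Z]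

/-! The Gottlieb group of a mapping space can be described without self-maps of that space.
Restricting a self-map of `NullMap X y₀` to the constant maps gives, by adjunction, a map X → C(Y,
Y); conversely φ : X → C(Y, Y) acts on maps by m ↦ (x ↦ φ(x)(m(x))). So, inside π_n(C(X, Y)), the
Gottlieb group is the image of π_n(C(X, C(Y, Y))) under composition with evaluation at y₀
(`map_gottliebGroup_nullMap`).

It remains to split such images, for ω : Z → Z' with Z = C(Y, Y) and Z' = Y. The constant maps split
evaluation at x₀ and leave π_n of the based maps X → Z. By adjunction its elements are based
homotopy classes of maps ΣX → Ω^(n-1) Z, and the splitting of ΣX turns these into families in ∏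
π_(n+i_r)(Z). The resulting function `splitClass` is natural in Z, but for n = 1 it need not be a
homomorphism, as the equivalence of ΣX with a wedge need not respect comultiplications.

Two facts make up for this. Composition is a strictly unital multiplication on Z, so by
Eckmann–Hilton `splitClass` is a surjective homomorphism for Z (`splitHom`). For Z' it is enough
that `splitClass` takes the value 1 only at 1 (`eq_one_of_splitClass_eq_one`). By naturality the
homomorphisms from π_n(Z) × ∏ π_(n+i_r)(Z) onto the image for C(X, -) and onto the product of images
for ω then have the same kernel, so the two are isomorphic (`nonempty_range_mulEquiv`).

A product X' × X'' reduces to X' by the exponential law, with Z = C(X'', C(Y, Y)) and Z' = C(X'',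
Y). For the circle, well-pointedness and ΣS¹ ≅ S² are verified explicitly. -/

theorem homotopic_of_map {z : Z} {p q : Ω^ N Z z} (H : I × (I^N) → Z) (hc : Continuous H)
    (h0 : ∀ t, H (0, t) = p t) (h1 : ∀ t, H (1, t) = q t)
    (hb : ∀ s, ∀ t ∈ Cube.boundary N, H (s, t) = z) : GenLoop.Homotopic p q :=
  ⟨{ toFun := H
     continuous_toFun := hc
     map_zero_left := h0
     map_one_left := h1
     prop' := fun s t ht => (hb s t ht).trans (p.2 t ht).symm }⟩

theorem exists_map_of_homotopic {z : Z} {p q : Ω^ N Z z} (h : GenLoop.Homotopic p q) :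
    ∃ H : C(I × (I^N), Z), (∀ t, H (0, t) = p t) ∧ (∀ t, H (1, t) = q t) ∧
      ∀ s, ∀ t ∈ Cube.boundary N, H (s, t) = z := by
  obtain ⟨H⟩ := h
  exact ⟨H.toContinuousMap, H.apply_zero, H.apply_one,
    fun s t ht => (H.eq_fst s ht).trans (p.2 t ht)⟩

/-- The class of a loop in the homotopy group. -/
def loopClass {z : Z} (p : Ω^ N Z z) : HomotopyGroup N Z z := Quotient.mk _ p

theorem loopClass_surjective {z : Z} : Function.Surjective (loopClass (N := N) (z := z)) :=
  Quotient.mk_surjective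

theorem loopClass_eq_iff {z : Z} {p q : Ω^ N Z z} :
    loopClass p = loopClass q ↔ GenLoop.Homotopic p q :=
  Quotient.eq (r := GenLoop.Homotopic.setoid N z)

@[simp] theorem mapGenLoop_apply {x : X} {y : Y} (f : C(X, Y)) (hf : f x = y) (p : Ω^ N X x)
    (t : I^N) : mapGenLoop f hf p t = f (p t) := rfl

variable [DecidableEq N]

theorem transAt_apply {z : Z} (i : N) (f g : Ω^ N Z z) (t : I^N) :
    GenLoop.transAt i f g t = if (t i : ℝ) ≤ 1 / 2
      then f (Function.update t i <| Set.projIcc 0 1 zero_le_one (2 * t i))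
      else g (Function.update t i <| Set.projIcc 0 1 zero_le_one (2 * t i - 1)) := rfl

variable [Nonempty N]

@[simp] theorem inducedHom_loopClass {x : X} {y : Y} (f : C(X, Y)) (hf : f x = y) (p : Ω^ N X x) :
    inducedHom N f hf (loopClass p) = loopClass (mapGenLoop f hf p) := rfl

/-- The order is reversed: `transAt i q p` runs through `q` first. -/
theorem loopClass_transAt {z : Z} (i : N) (p q : Ω^ N Z z) :
    loopClass (GenLoop.transAt i q p) =
      loopClass p * loopClass q :=
  (HomotopyGroup.mul_spec (i := i) (p := p) (q := q)).symm

theorem loopClass_symmAt {z : Z} (i : N) (p : Ω^ N Z z) :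
    loopClass (GenLoop.symmAt i p) =
      (loopClass p)⁻¹ :=
  (HomotopyGroup.inv_spec (i := i) (p := p)).symm

theorem loopClass_const {z : Z} :
    loopClass (GenLoop.const : Ω^ N Z z) = 1 := rfl

theorem loopClass_eq_one {z : Z} {p : Ω^ N Z z} :
    loopClass p = 1 ↔ GenLoop.Homotopic p GenLoop.const :=
  loopClass_eq_iff

end Loops

/-! ### Pointwise products of loops in a space with a strictly unital multiplication -/

section StrictUnit

variable {N : Type*} {B : Type*} [TopologicalSpace B] {e : B} (μ : C(B × B, B))

/-- The pointwise product of two loops. -/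
def mulLoop (he : μ (e, e) = e) (p q : Ω^ N B e) : Ω^ N B e :=
  ⟨μ.comp (p.1.prodMk q.1), fun t ht =>
    (congrArg μ (Prod.ext (p.2 t ht) (q.2 t ht))).trans he⟩

theorem mulLoop_apply (he : μ (e, e) = e) (p q : Ω^ N B e) (t : I^N) :
    mulLoop μ he p q t = μ (p t, q t) := rfl

theorem mulLoop_homotopic (he : μ (e, e) = e) {p p' q q' : Ω^ N B e}
    (hp : GenLoop.Homotopic p p') (hq : GenLoop.Homotopic q q') :
    GenLoop.Homotopic (mulLoop μ he p q) (mulLoop μ he p' q') := by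
  obtain ⟨F, F0, F1, Fb⟩ := exists_map_of_homotopic hp
  obtain ⟨G, G0, G1, Gb⟩ := exists_map_of_homotopic hq
  refine homotopic_of_map (fun x => μ (F x, G x)) (by fun_prop) ?_ ?_ ?_
  · intro t; simp only [F0, G0, mulLoop_apply]
  · intro t; simp only [F1, G1, mulLoop_apply]
  · intro s t ht; simp only [Fb s t ht, Gb s t ht, he]

variable [DecidableEq N] [Nonempty N]

/-- Eckmann–Hilton. As the unit is strict, a concatenation equals the pointwise product of the two
loops, each padded by the constant loop on the other half; removing the padding is a homotopy. -/
theorem loopClass_mulLoop (hl : ∀ b, μ (e, b) = b) (hr : ∀ b, μ (b, e) = b)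
    (p q : Ω^ N B e) :
    loopClass (mulLoop μ (hl e) p q) =
      loopClass p * loopClass q := by
  let i := Classical.arbitrary N
  rw [← loopClass_transAt i]
  have h : GenLoop.transAt i q p = mulLoop μ (hl e) (GenLoop.transAt i GenLoop.const p)
      (GenLoop.transAt i q GenLoop.const) := by
    ext t
    simp only [mulLoop_apply, transAt_apply]
    split_ifs <;> simp [hl, hr]
  rw [h]
  refine loopClass_eq_iff.2 (mulLoop_homotopic μ _ ?_ ?_) <;> refine loopClass_eq_iff.1 ?_ <;>
    simp only [loopClass_transAt, loopClass_const, mul_one, one_mul]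

/-- Padding on the opposite halves turns the same pointwise product into the concatenation in the
other order. This covers π₁ as well. -/
theorem homotopyGroup_mul_comm (hl : ∀ b, μ (e, b) = b) (hr : ∀ b, μ (b, e) = b)
    (a b : HomotopyGroup N B e) : a * b = b * a := by
  obtain ⟨p, rfl⟩ := loopClass_surjective a
  obtain ⟨q, rfl⟩ := loopClass_surjective b
  let i := Classical.arbitrary N
  refine (loopClass_mulLoop μ hl hr p q).symm.trans (Eq.trans ?_ (loopClass_transAt i q p))
  have h : GenLoop.transAt i p q = mulLoop μ (hl e) (GenLoop.transAt i p GenLoop.const)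
      (GenLoop.transAt i GenLoop.const q) := by
    ext t
    simp only [mulLoop_apply, transAt_apply]
    split_ifs <;> simp [hl, hr]
  rw [h]
  refine loopClass_eq_iff.2 (mulLoop_homotopic μ _ ?_ ?_) <;> refine loopClass_eq_iff.1 ?_ <;>
    simp only [loopClass_transAt, loopClass_const, mul_one, one_mul]

end StrictUnit

/-! ### The homotopy extension property -/

/-- Frees the test space from the universe of `X`. The universal test space X × {0} ∪ {x₀} × I lies
in that universe and yields a retraction `r` of X × I; any `f` and `h` glue on it, because both
pieces are closed. -/
theorem WellPointed.extend {X : Type u} [TopologicalSpace X] [T1Space X] {x₀ : X}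
    (hX : WellPointed x₀) {Z : Type v} [TopologicalSpace Z] (f : C(X, Z)) (h : C(I, Z))
    (h0 : h 0 = f x₀) : ∃ F : C(X × I, Z), (∀ x, F (x, 0) = f x) ∧ ∀ t, F (x₀, t) = h t := by
  classical
  let R := {p : X × I // p.2 = 0 ∨ p.1 = x₀}
  obtain ⟨r, r0, r1⟩ := hX R ⟨fun x => ⟨(x, 0), Or.inl rfl⟩, by fun_prop⟩
    ⟨fun t => ⟨(x₀, t), Or.inr rfl⟩, by fun_prop⟩ rfl
  let g : R → Z := fun p => if p.1.2 = 0 then f p.1.1 else h p.1.2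
  have g0 : ∀ p : R, p.1.2 = 0 → g p = f p.1.1 := fun p hp => if_pos hp
  have g1 : ∀ p : R, p.1.1 = x₀ → g p = h p.1.2 := fun p hp => by
    by_cases h' : p.1.2 = 0
    · rw [g0 p h', hp, h', h0]
    · exact if_neg h'
  have hg : Continuous g := by
    have hu : {p : R | p.1.2 = 0} ∪ {p : R | p.1.1 = x₀} = Set.univ :=
      Set.eq_univ_of_forall fun p => p.2
    rw [← continuousOn_univ, ← hu]
    refine ContinuousOn.union_of_isClosed ?_ ?_ ?_ ?_
    · exact ContinuousOn.congr (f := fun p : R => f p.1.1) (by fun_prop) fun p hp => g0 p hp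
    · exact ContinuousOn.congr (f := fun p : R => h p.1.2) (by fun_prop) fun p hp => g1 p hp
    · exact isClosed_singleton.preimage (by fun_prop : Continuous fun p : R => p.1.2)
    · exact isClosed_singleton.preimage (by fun_prop : Continuous fun p : R => p.1.1)
  refine ⟨⟨g ∘ r, hg.comp r.continuous⟩, fun x => ?_, fun t => ?_⟩
  · simp only [ContinuousMap.coe_mk, Function.comp_apply, r0]; exact g0 _ rfl
  · simp only [ContinuousMap.coe_mk, Function.comp_apply, r1]; exact g1 _ rfl

/-! ### Spaces of based maps -/

section Based

variable {N : Type*} {X : Type u} {Z : Type v} [TopologicalSpace X] [TopologicalSpace Z]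

/-- The space of maps `X → Z` taking `x₀` to `z`. -/
abbrev BasedMap (x₀ : X) (z : Z) : Type (max u v) := {f : C(X, Z) // f x₀ = z}

/-- The constant map, as base point of the space of based maps. -/
def BasedMap.base (x₀ : X) (z : Z) : BasedMap x₀ z := ⟨ContinuousMap.const X z, rfl⟩

/-- The inclusion of the based maps in all maps. -/
def BasedMap.incl (x₀ : X) (z : Z) : C(BasedMap x₀ z, C(X, Z)) := ⟨Subtype.val, by fun_prop⟩

/-- Evaluation at `x` as a continuous map. -/
def evalAt (Z : Type*) [TopologicalSpace Z] (x : X) : C(C(X, Z), Z) :=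
  ⟨fun f => f x, continuous_eval_const x⟩

variable {x₀ : X} {z : Z}

/-- A loop in the space of based maps, from the adjoint map. -/
def basedLoop (x₀ : X) (z : Z) (G : (I^N) × X → Z) (hG : Continuous G)
    (hb : ∀ t ∈ Cube.boundary N, ∀ x, G (t, x) = z) (h0 : ∀ t, G (t, x₀) = z) :
    Ω^ N (BasedMap x₀ z) (BasedMap.base x₀ z) :=
  ⟨⟨fun t => ⟨(ContinuousMap.mk G hG).curry t, h0 t⟩,
    (ContinuousMap.continuous _).subtype_mk _⟩,
    fun t ht => Subtype.ext (ContinuousMap.ext fun x => hb t ht x)⟩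

@[simp] theorem basedLoop_apply (G : (I^N) × X → Z) (hG : Continuous G)
    (hb : ∀ t ∈ Cube.boundary N, ∀ x, G (t, x) = z) (h0 : ∀ t, G (t, x₀) = z) (t : I^N) (x : X) :
    (basedLoop x₀ z G hG hb h0 t).1 x = G (t, x) := rfl

/-- A loop in the space of all maps, from the adjoint map. -/
def freeLoop (z : Z) (G : (I^N) × X → Z) (hG : Continuous G)
    (hb : ∀ t ∈ Cube.boundary N, ∀ x, G (t, x) = z) :
    Ω^ N C(X, Z) (ContinuousMap.const X z) :=
  ⟨(ContinuousMap.mk G hG).curry, fun t ht => ContinuousMap.ext fun x => hb t ht x⟩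

theorem based_homotopic_of_map {p q : Ω^ N (BasedMap x₀ z) (BasedMap.base x₀ z)}
    (H : I × (I^N) × X → Z) (hc : Continuous H) (h0 : ∀ t x, H (0, t, x) = (p t).1 x)
    (h1 : ∀ t x, H (1, t, x) = (q t).1 x)
    (hb : ∀ s, ∀ t ∈ Cube.boundary N, ∀ x, H (s, t, x) = z) (hx : ∀ s t, H (s, t, x₀) = z) :
    GenLoop.Homotopic p q := by
  let K : C((I × (I^N)) × X, Z) := ⟨fun a => H (a.1.1, a.1.2, a.2), by fun_prop⟩
  refine homotopic_of_map (fun a => ⟨K.curry a, hx a.1 a.2⟩)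
    (K.curry.continuous.subtype_mk _) ?_ ?_ ?_
  · exact fun t => Subtype.ext (ContinuousMap.ext fun x => h0 t x)
  · exact fun t => Subtype.ext (ContinuousMap.ext fun x => h1 t x)
  · exact fun s t ht => Subtype.ext (ContinuousMap.ext fun x => hb s t ht x)

theorem free_homotopic_of_map {p q : Ω^ N C(X, Z) (ContinuousMap.const X z)}
    (H : I × (I^N) × X → Z) (hc : Continuous H) (h0 : ∀ t x, H (0, t, x) = p t x)
    (h1 : ∀ t x, H (1, t, x) = q t x)
    (hb : ∀ s, ∀ t ∈ Cube.boundary N, ∀ x, H (s, t, x) = z) :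
    GenLoop.Homotopic p q := by
  let K : C((I × (I^N)) × X, Z) := ⟨fun a => H (a.1.1, a.1.2, a.2), by fun_prop⟩
  refine homotopic_of_map (fun a => K.curry a) K.curry.continuous ?_ ?_ ?_
  · exact fun t => ContinuousMap.ext fun x => h0 t x
  · exact fun t => ContinuousMap.ext fun x => h1 t x
  · exact fun s t ht => ContinuousMap.ext fun x => hb s t ht x

/-- Homotopy lifting for the evaluation C(X, Z) → Z, relative to the boundary of the cube. Extending
with values in the loop space `Ω^ N Z z`, not in `Z`, keeps the boundary condition. -/
theorem WellPointed.extend_loop [LocallyCompactSpace X] [T2Space X] (hX : WellPointed x₀)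
    (P : Ω^ N C(X, Z) (ContinuousMap.const X z)) (K : C(I × (I^N), Z))
    (K0 : ∀ t, K (0, t) = P t x₀) (Kb : ∀ s, ∀ t ∈ Cube.boundary N, K (s, t) = z) :
    ∃ F : C(I × (I^N) × X, Z), (∀ t x, F (0, t, x) = P t x) ∧
      (∀ s t, F (s, t, x₀) = K (s, t)) ∧ ∀ s, ∀ t ∈ Cube.boundary N, ∀ x, F (s, t, x) = z := by
  let P' : C(X × (I^N), Z) := ⟨fun a => P a.2 a.1, by fun_prop⟩
  obtain ⟨F, F0, F1⟩ := hX.extend (Z := Ω^ N Z z)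
    ⟨fun x => ⟨P'.curry x, fun t ht => congrArg (fun f : C(X, Z) => f x) (P.2 t ht)⟩,
      P'.curry.continuous.subtype_mk _⟩
    ⟨fun s => ⟨K.curry s, fun t ht => Kb s t ht⟩, K.curry.continuous.subtype_mk _⟩
    (GenLoop.ext _ _ K0)
  refine ⟨⟨fun a => F (a.2.2, a.1) a.2.1, by fun_prop⟩, fun t x => ?_, fun s t => ?_, ?_⟩
  · exact congrArg (fun p : Ω^ N Z z => p t) (F0 x)
  · exact congrArg (fun p : Ω^ N Z z => p t) (F1 s)
  · exact fun s t ht x => (F (x, s)).2 t ht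

theorem exists_based_homotopic [LocallyCompactSpace X] [T2Space X] (hX : WellPointed x₀)
    (P : Ω^ N C(X, Z) (ContinuousMap.const X z))
    (hP : GenLoop.Homotopic (mapGenLoop (evalAt Z x₀) rfl P) (GenLoop.const (x := z))) :
    ∃ Q : Ω^ N (BasedMap x₀ z) (BasedMap.base x₀ z),
      GenLoop.Homotopic P (mapGenLoop (BasedMap.incl x₀ z) rfl Q) := by
  obtain ⟨K, K0, K1, Kb⟩ := exists_map_of_homotopic hP
  obtain ⟨F, F0, F1, Fb⟩ := hX.extend_loop P K K0 Kb
  exact ⟨basedLoop x₀ z (fun a => F (1, a.1, a.2)) (by fun_prop) (fun t ht x => Fb 1 t ht x)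
    fun t => (F1 1 t).trans (K1 t), free_homotopic_of_map F F.continuous F0 (fun _ _ => rfl) Fb⟩

variable [DecidableEq N] [Nonempty N]

/-- A free null-homotopy of a based loop moves the base point along some `h`, an N-dimensional loop
in ΩZ. Since constant maps are a section of evaluation, this motion can be cancelled by the inverse
of `h`, spread constantly over `X`; the homotopy extension property then makes the null-homotopy
based. -/
theorem homotopic_const_of_incl [LocallyCompactSpace X] [T2Space X] (hX : WellPointed x₀)
    (Q : Ω^ N (BasedMap x₀ z) (BasedMap.base x₀ z))
    (hQ : GenLoop.Homotopic (mapGenLoop (BasedMap.incl x₀ z) rfl Q)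
      (GenLoop.const (x := ContinuousMap.const X z))) :
    GenLoop.Homotopic Q GenLoop.const := by
  obtain ⟨H, H0, H1, Hb⟩ := exists_map_of_homotopic hQ
  let i := Classical.arbitrary N
  let L := {γ : C(I, Z) // γ 0 = z ∧ γ 1 = z}
  let l₀ : L := ⟨ContinuousMap.const I z, rfl, rfl⟩
  let j : C(L, C(I, Z)) := ⟨Subtype.val, by fun_prop⟩
  let c : C(L, C(X, C(I, Z))) := ContinuousMap.const'.comp j
  let S : C(((I^N) × X) × I, Z) := ⟨fun a => H (a.2, a.1.1) a.1.2, by fun_prop⟩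
  let Ĥ : Ω^ N C(X, C(I, Z)) (ContinuousMap.const X (ContinuousMap.const I z)) :=
    freeLoop _ (fun a => S.curry a) S.curry.continuous fun t ht x =>
      ContinuousMap.ext fun s => congrArg (fun f : C(X, Z) => f x) (Hb s t ht)
  let T : C((I^N) × I, Z) := ⟨fun a => H (a.2, a.1) x₀, by fun_prop⟩
  let h : Ω^ N L l₀ := ⟨⟨fun t => ⟨T.curry t,
      (congrArg (fun f : C(X, Z) => f x₀) (H0 t)).trans (Q t).2,
      congrArg (fun f : C(X, Z) => f x₀) (H1 t)⟩, T.curry.continuous.subtype_mk _⟩,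
    fun t ht => Subtype.ext (ContinuousMap.ext fun s =>
      congrArg (fun f : C(X, Z) => f x₀) (Hb s t ht))⟩
  -- At `x₀` this is the inverse of `h` followed by `h`, hence null-homotopic in `L` through paths
  -- with both ends at `z`.
  let H' := GenLoop.transAt i
    (mapGenLoop (y := ContinuousMap.const X (ContinuousMap.const I z)) c rfl (GenLoop.symmAt i h)) Ĥ
  have hG : GenLoop.Homotopic (GenLoop.transAt i (GenLoop.symmAt i h) h) GenLoop.const := by
    rw [← loopClass_eq_one, loopClass_transAt, loopClass_symmAt, mul_inv_cancel]
  obtain ⟨G, G0, G1, Gb⟩ := exists_map_of_homotopic hG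
  obtain ⟨F, F0, F1, Fb⟩ := hX.extend_loop H' (j.comp G)
    (fun t => by
      rw [ContinuousMap.comp_apply, G0]
      simp only [H', transAt_apply]
      split_ifs <;> rfl)
    (fun s t ht => by rw [ContinuousMap.comp_apply, Gb s t ht]; rfl)
  have F1' : ∀ s t (τ : I), τ = 0 ∨ τ = 1 → F (s, t, x₀) τ = z := by
    rintro s t τ (rfl | rfl)
    · rw [F1]; exact (G (s, t)).2.1
    · rw [F1]; exact (G (s, t)).2.2
  have F1'' : ∀ t τ, F (1, t, x₀) τ = z := by
    intro t τ
    rw [F1, ContinuousMap.comp_apply, G1]; rfl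
  have Fb' : ∀ s, ∀ t ∈ Cube.boundary N, ∀ x τ, F (s, t, x) τ = z := by
    intro s t ht x τ
    rw [Fb s t ht]; rfl
  let edge (s τ : I) (hτ : τ = 0 ∨ τ = 1) : Ω^ N (BasedMap x₀ z) (BasedMap.base x₀ z) :=
    basedLoop x₀ z (fun a => F (s, a.1, a.2) τ) (by fun_prop)
      (fun t ht x => Fb' s t ht x τ) fun t => F1' s t τ hτ
  have e0 : edge 0 0 (Or.inl rfl) = GenLoop.transAt i GenLoop.const Q := by
    refine GenLoop.ext _ _ fun t => Subtype.ext (ContinuousMap.ext fun x => ?_)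
    simp only [edge, basedLoop_apply, F0, H', transAt_apply]
    split_ifs
    · exact (GenLoop.symmAt i h _).2.1
    · exact congrArg (fun f : C(X, Z) => f x) (H0 _)
  have e1 : edge 0 1 (Or.inr rfl) = GenLoop.const := by
    refine GenLoop.ext _ _ fun t => Subtype.ext (ContinuousMap.ext fun x => ?_)
    simp only [edge, basedLoop_apply, F0, H', transAt_apply]
    split_ifs
    · exact (GenLoop.symmAt i h _).2.2
    · exact congrArg (fun f : C(X, Z) => f x) (H1 _)
  have side : ∀ τ hτ, GenLoop.Homotopic (edge 0 τ hτ) (edge 1 τ hτ) := fun τ hτ =>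
    based_homotopic_of_map (fun a => F a τ) (by fun_prop) (fun _ _ => rfl) (fun _ _ => rfl)
      (fun s t ht x => Fb' s t ht x τ) fun s t => F1' s t τ hτ
  have top : GenLoop.Homotopic (edge 1 0 (Or.inl rfl)) (edge 1 1 (Or.inr rfl)) :=
    based_homotopic_of_map (fun a => F (1, a.2) a.1) (by fun_prop) (fun _ _ => rfl)
      (fun _ _ => rfl) (fun s t ht x => Fb' 1 t ht x s) fun s t => F1'' t s
  have key := ((side 0 (Or.inl rfl)).trans top).trans (side 1 (Or.inr rfl)).symm
  rw [e0, e1, ← loopClass_eq_one, loopClass_transAt, loopClass_const, mul_one,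
    loopClass_eq_one] at key
  exact key

theorem inducedHom_incl_injective [LocallyCompactSpace X] [T2Space X] (hX : WellPointed x₀) :
    Function.Injective (inducedHom N (BasedMap.incl x₀ z) (x := BasedMap.base x₀ z) rfl) := by
  rw [injective_iff_map_eq_one]
  intro a ha
  obtain ⟨Q, rfl⟩ := loopClass_surjective a
  rw [inducedHom_loopClass] at ha
  exact loopClass_eq_one.2 (homotopic_const_of_incl hX Q (loopClass_eq_one.1 ha))

theorem exists_inducedHom_incl_eq [LocallyCompactSpace X] [T2Space X] (hX : WellPointed x₀)
    (a : HomotopyGroup N C(X, Z) (ContinuousMap.const X z))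
    (ha : inducedHom N (evalAt Z x₀) (y := z) rfl a = 1) :
    ∃ b, inducedHom N (BasedMap.incl x₀ z) (x := BasedMap.base x₀ z) rfl b = a := by
  obtain ⟨P, rfl⟩ := loopClass_surjective a
  obtain ⟨Q, hQ⟩ := exists_based_homotopic hX P (loopClass_eq_one.1 ha)
  exact ⟨loopClass Q, (loopClass_eq_iff.2 hQ).symm⟩

end Based

/-! ### Collapse maps -/

/-- `q : P → T` is a quotient map that collapses `A` to `t₀` and identifies nothing else. -/
structure IsCollapse {P T : Type*} [TopologicalSpace P] [TopologicalSpace T] (q : P → T)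
    (A : Set P) (t₀ : T) : Prop where
  isQuotientMap : Topology.IsQuotientMap q
  eq_base_iff : ∀ p, q p = t₀ ↔ p ∈ A
  eq_or_mem : ∀ p p', q p = q p' → p = p' ∨ p ∈ A

theorem isCollapse_mk {T : Type*} [TopologicalSpace T] (A : Set T) {a : T} (ha : a ∈ A) :
    IsCollapse (Quotient.mk (collapseSetoid A)) A (Quotient.mk _ a) where
  isQuotientMap := isQuotientMap_quot_mk
  eq_base_iff p := by
    rw [Quotient.eq]
    constructor
    · rintro (rfl | h)
      exacts [ha, h.1]
    · exact fun h => Or.inr ⟨h, ha⟩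
  eq_or_mem p p' h := by
    rw [Quotient.eq] at h
    exact h.imp_right And.left

/-- Local compactness of `Q` makes q × id a quotient map. The parameter space `Q` later carries the
cube coordinates and the time of a homotopy. -/
theorem IsCollapse.lift_prod {P T Q Z : Type*} [TopologicalSpace P] [TopologicalSpace T]
    [TopologicalSpace Q] [LocallyCompactSpace Q] [TopologicalSpace Z] {q : P → T} {A : Set P}
    {t₀ : T} (h : IsCollapse q A t₀) {z : Z} (G : P × Q → Z) (hG : Continuous G)
    (hA : ∀ p ∈ A, ∀ u, G (p, u) = z) :
    ∃ G' : C(T × Q, Z), (∀ p u, G' (q p, u) = G (p, u)) ∧ ∀ u, G' (t₀, u) = z := by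
  -- A set-theoretic section, not continuous; by `key` the choice does not affect `G`.
  let s := Function.surjInv h.isQuotientMap.surjective
  have hs : ∀ y, q (s y) = y := Function.surjInv_eq _
  have key : ∀ p u, G (s (q p), u) = G (p, u) := by
    intro p u
    rcases h.eq_or_mem _ _ (hs (q p)) with h1 | h1
    · rw [h1]
    · rw [hA _ h1, hA p]
      rw [← h.eq_base_iff, ← hs (q p)]
      exact (h.eq_base_iff _).2 h1
  refine ⟨⟨fun a => G (s a.1, a.2), ?_⟩, key, fun u => hA _ ?_ u⟩
  · refine h.isQuotientMap.continuous_lift_prod_left ?_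
    simpa only [key] using hG
  · rw [← h.eq_base_iff, hs]

theorem suspension_isCollapse {X : Type*} [TopologicalSpace X] (x₀ : X) :
    IsCollapse (Quotient.mk _ : X × I → Suspension x₀) {p : X × I | p.1 = x₀ ∨ p.2 = 0 ∨ p.2 = 1}
      (Suspension.base x₀) :=
  isCollapse_mk _ (Or.inl rfl)

/-- The inclusion of a member of the family in the wedge. -/
def Wedge.inc {ι : Type*} {S : ι → Type*} [∀ r, TopologicalSpace (S r)] (s : ∀ r, S r) (r : ι) :
    C(S r, Wedge s) :=
  ⟨fun y => Quotient.mk _ (Sum.inr ⟨r, y⟩), continuous_quotient_mk'.comp (by fun_prop)⟩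

theorem Wedge.inc_base {ι : Type*} {S : ι → Type*} [∀ r, TopologicalSpace (S r)] (s : ∀ r, S r)
    (r : ι) : Wedge.inc s r (s r) = Wedge.base s :=
  Quotient.sound (Or.inr ⟨Or.inr ⟨r, rfl⟩, Or.inl rfl⟩)

theorem Wedge.eq_base_or_inc {ι : Type*} {S : ι → Type*} [∀ r, TopologicalSpace (S r)]
    (s : ∀ r, S r) (w : Wedge s) : w = Wedge.base s ∨ ∃ r y, w = Wedge.inc s r y := by
  obtain ⟨⟨⟩ | ⟨r, y⟩, rfl⟩ := Quotient.exists_rep w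
  · exact Or.inl rfl
  · exact Or.inr ⟨r, y, rfl⟩

theorem Wedge.lift_prod {ι : Type*} {S : ι → Type*} [∀ r, TopologicalSpace (S r)] {s : ∀ r, S r}
    {P : ι → Type*} [∀ r, TopologicalSpace (P r)] {A : ∀ r, Set (P r)} {q : ∀ r, P r → S r}
    (hq : ∀ r, IsCollapse (q r) (A r) (s r)) {Q Z : Type*} [TopologicalSpace Q]
    [LocallyCompactSpace Q] [TopologicalSpace Z] {z : Z} (G : ∀ r, P r × Q → Z)
    (hG : ∀ r, Continuous (G r)) (hA : ∀ r, ∀ p ∈ A r, ∀ u, G r (p, u) = z) :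
    ∃ G' : C(Wedge s × Q, Z), (∀ r p u, G' (Wedge.inc s r (q r p), u) = G r (p, u)) ∧
      ∀ u, G' (Wedge.base s, u) = z := by
  choose g hg hg' using fun r => (hq r).lift_prod (G r) (hG r) (hA r)
  let F : (Unit ⊕ Σ r, S r) → C(Q, Z) :=
    Sum.elim (fun _ => ContinuousMap.const Q z) fun a => (g a.1).curry a.2
  have hF : Continuous F := by
    rw [continuous_sum_dom]
    refine ⟨continuous_const, ?_⟩
    rw [continuous_sigma_iff]
    exact fun r => (g r).curry.continuous
  obtain ⟨G', h1, h2⟩ := (isCollapse_mk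
    (insert (Sum.inl ()) (Set.range fun r => (Sum.inr ⟨r, s r⟩ : Unit ⊕ Σ r, S r)))
    (Set.mem_insert _ _)).lift_prod (z := z) (fun a : _ × Q => F a.1 a.2) (by fun_prop) (by
      rintro _ (rfl | ⟨r, rfl⟩) u
      · rfl
      · exact hg' r u)
  exact ⟨G', fun r p u => (h1 _ u).trans (hg r p u), h2⟩

/-! ### Products of cubes -/

section Cubes

variable {D L K : Type*} (e : D ⊕ L ≃ K)

/-- The point of a cube with given coordinates in two complementary faces. -/
def joinCube : C((I^L) × (I^D), I^K) :=
  ⟨fun a k => Sum.elim a.2 a.1 (e.symm k), by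
    refine continuous_pi fun k => ?_
    rcases e.symm k with d | l
    · exact (continuous_apply d).comp continuous_snd
    · exact (continuous_apply l).comp continuous_fst⟩

/-- The first group of coordinates. -/
def leftCube : C(I^K, I^D) := ⟨fun t d => t (e (Sum.inl d)), by fun_prop⟩

/-- The second group of coordinates. -/
def rightCube : C(I^K, I^L) := ⟨fun t l => t (e (Sum.inr l)), by fun_prop⟩

@[simp] theorem leftCube_joinCube (a : (I^L) × (I^D)) : leftCube e (joinCube e a) = a.2 := by
  ext d; simp [leftCube, joinCube]

@[simp] theorem rightCube_joinCube (a : (I^L) × (I^D)) : rightCube e (joinCube e a) = a.1 := by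
  ext d; simp [rightCube, joinCube]

@[simp] theorem joinCube_leftCube (t : I^K) : joinCube e (rightCube e t, leftCube e t) = t := by
  ext k
  obtain ⟨d | l, rfl⟩ := e.surjective k <;> simp [leftCube, rightCube, joinCube]

theorem mem_boundary_iff (t : I^K) : t ∈ Cube.boundary K ↔
    rightCube e t ∈ Cube.boundary L ∨ leftCube e t ∈ Cube.boundary D := by
  constructor
  · rintro ⟨k, hk⟩
    obtain ⟨d | l, rfl⟩ := e.surjective k
    · exact Or.inr ⟨d, hk⟩
    · exact Or.inl ⟨l, hk⟩
  · rintro (⟨l, h⟩ | ⟨d, h⟩)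
    · exact ⟨_, h⟩
    · exact ⟨_, h⟩

end Cubes

/-! ### Adjoints of based maps into a space of loops -/

section AdjMap

variable {T T' Z Z' : Type*} [TopologicalSpace T] [TopologicalSpace T'] [TopologicalSpace Z]
  [TopologicalSpace Z']

/-- The maps `T × I^D → Z` that are adjoint to based maps from `(T, t₀)` to `Ω^D Z`. -/
abbrev AdjMap (t₀ : T) (D : Type*) (z : Z) : Type _ :=
  {k : C(T × (I^D), Z) // (∀ u, k (t₀, u) = z) ∧ ∀ p, ∀ u ∈ Cube.boundary D, k (p, u) = z}

namespace AdjMap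

variable {t₀ : T} {t₀' : T'} {D : Type*} {z : Z} {z' : Z'}

/-- Based homotopies. -/
def Homotopic (k k' : AdjMap t₀ D z) : Prop :=
  ∃ H : C(T × ((I^D) × I), Z), (∀ p u, H (p, u, 0) = k.1 (p, u)) ∧
    (∀ p u, H (p, u, 1) = k'.1 (p, u)) ∧ (∀ u s, H (t₀, u, s) = z) ∧
    ∀ p, ∀ u ∈ Cube.boundary D, ∀ s, H (p, u, s) = z

/-- Composition with a based map of the source. -/
def comp (k : AdjMap t₀' D z) (f : C(T, T')) (hf : f t₀ = t₀') : AdjMap t₀ D z :=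
  ⟨⟨fun a => k.1 (f a.1, a.2), by fun_prop⟩, fun u => (congrArg (fun y => k.1 (y, u)) hf).trans
    (k.2.1 u), fun p u hu => k.2.2 (f p) u hu⟩

theorem comp_apply (k : AdjMap t₀' D z) (f : C(T, T')) (hf : f t₀ = t₀') (a : T × (I^D)) :
    (k.comp f hf).1 a = k.1 (f a.1, a.2) := rfl

/-- Composition with a based map of the target. -/
def map (ω : C(Z, Z')) (hω : ω z = z') (k : AdjMap t₀ D z) : AdjMap t₀ D z' :=
  ⟨ω.comp k.1, fun u => (congrArg ω (k.2.1 u)).trans hω,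
    fun p u hu => (congrArg ω (k.2.2 p u hu)).trans hω⟩

/-- The pointwise product. -/
def mul (μ : C(Z × Z, Z)) (hz : μ (z, z) = z) (k k' : AdjMap t₀ D z) : AdjMap t₀ D z :=
  ⟨μ.comp (k.1.prodMk k'.1), fun u => (congrArg μ (Prod.ext (k.2.1 u) (k'.2.1 u))).trans hz,
    fun p u hu => (congrArg μ (Prod.ext (k.2.2 p u hu) (k'.2.2 p u hu))).trans hz⟩

theorem Homotopic.comp {k k' : AdjMap t₀' D z} (h : k.Homotopic k') (f : C(T, T'))
    (hf : f t₀ = t₀') : (k.comp f hf).Homotopic (k'.comp f hf) := by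
  obtain ⟨H, H0, H1, Ht, Hb⟩ := h
  refine ⟨⟨fun a => H (f a.1, a.2), by fun_prop⟩, fun p u => H0 _ _, fun p u => H1 _ _,
    fun u s => ?_, fun p u hu s => Hb _ u hu s⟩
  simp only [ContinuousMap.coe_mk, hf, Ht]

theorem comp_homotopic (k : AdjMap t₀' D z) {f f' : C(T, T')} (hf : f t₀ = t₀')
    (hf' : f' t₀ = t₀') (h : f.HomotopicRel f' {t₀}) :
    (k.comp f hf).Homotopic (k.comp f' hf') := by
  obtain ⟨H⟩ := h
  refine ⟨⟨fun a => k.1 (H (a.2.2, a.1), a.2.1), by fun_prop⟩, fun p u => ?_, fun p u => ?_,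
    fun u s => ?_, fun p u hu s => k.2.2 _ u hu⟩
  · simp [comp_apply]
  · simp [comp_apply]
  · simp only [ContinuousMap.coe_mk, H.eq_fst s (Set.mem_singleton t₀), hf, k.2.1]

variable {L K : Type*} (e : D ⊕ L ≃ K) (c : C(I^L, T)) (hc : ∀ a ∈ Cube.boundary L, c a = t₀)

/-- The loop obtained from an adjoint map and a cube in its source. -/
def loop (k : AdjMap t₀ D z) : Ω^ K Z z :=
  ⟨⟨fun t => k.1 (c (rightCube e t), leftCube e t), by fun_prop⟩, fun t ht => by
    rcases (mem_boundary_iff e t).1 ht with h | h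
    · exact (congrArg (fun y => k.1 (y, leftCube e t)) (hc _ h)).trans (k.2.1 _)
    · exact k.2.2 _ _ h⟩

theorem Homotopic.loop {k k' : AdjMap t₀ D z} (h : k.Homotopic k') :
    GenLoop.Homotopic (k.loop e c hc) (k'.loop e c hc) := by
  obtain ⟨H, H0, H1, Ht, Hb⟩ := h
  refine homotopic_of_map (fun a => H (c (rightCube e a.2), leftCube e a.2, a.1)) (by fun_prop)
    (fun t => H0 _ _) (fun t => H1 _ _) fun s t ht => ?_
  rcases (mem_boundary_iff e t).1 ht with h | h
  · simp only [hc _ h, Ht]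
  · exact Hb _ _ h s

end AdjMap

end AdjMap

/-! ### Adjoint maps on a wedge and families of loops -/

section Family

variable {ι : Type*} {S : ι → Type*} [∀ r, TopologicalSpace (S r)] {s : ∀ r, S r}
  {D : Type*} {L K : ι → Type*} (e : ∀ r, D ⊕ L r ≃ K r) {q : ∀ r, C(I^(L r), S r)}
  (hq : ∀ r, IsCollapse (q r) (Cube.boundary (L r)) (s r))
  {Z Z' : Type*} [TopologicalSpace Z] [TopologicalSpace Z'] {z : Z} {z' : Z'}

theorem IsCollapse.inc_comp_boundary {r : ι} (hq : IsCollapse (q r) (Cube.boundary (L r)) (s r)) :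
    ∀ a ∈ Cube.boundary (L r), (Wedge.inc s r).comp (q r) a = Wedge.base s := fun a ha =>
  (congrArg (Wedge.inc s r) ((hq.eq_base_iff a).2 ha)).trans (Wedge.inc_base s r)

/-- The loops that make up an adjoint map on a wedge. -/
def AdjMap.family (k : AdjMap (Wedge.base s) D z) (r : ι) : Ω^ (K r) Z z :=
  k.loop (e r) ((Wedge.inc s r).comp (q r)) (hq r).inc_comp_boundary

theorem AdjMap.family_apply (k : AdjMap (Wedge.base s) D z) (r : ι) (t : I^(K r)) :
    k.family e hq r t = k.1 (Wedge.inc s r (q r (rightCube (e r) t)), leftCube (e r) t) := rfl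

/-- With `exists_family_eq` this gives a bijection between adjoint maps on the wedge and families of
loops before passing to homotopy, so naturality and products can be checked on families. -/
theorem AdjMap.ext_family {k k' : AdjMap (Wedge.base s) D z}
    (h : k.family e hq = k'.family e hq) : k = k' := by
  refine Subtype.ext (ContinuousMap.ext ?_)
  rintro ⟨w, u⟩
  rcases Wedge.eq_base_or_inc s w with rfl | ⟨r, y, rfl⟩
  · rw [k.2.1, k'.2.1]
  · obtain ⟨a, rfl⟩ := (hq r).isQuotientMap.surjective y
    have := congrArg (fun p : Ω^ (K r) Z z => p (joinCube (e r) (a, u))) (congrFun h r)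
    simpa only [AdjMap.family_apply, rightCube_joinCube, leftCube_joinCube] using this

theorem exists_family_eq (b : ∀ r, Ω^ (K r) Z z) :
    ∃ k : AdjMap (Wedge.base s) D z, k.family e hq = b := by
  obtain ⟨G, h1, h2⟩ := Wedge.lift_prod hq (Q := I^D) (z := z)
    (fun r a => b r (joinCube (e r) a)) (fun r => by fun_prop) (fun r a ha u =>
      (b r).2 _ ((mem_boundary_iff (e r) _).2 (Or.inl (by simpa using ha))))
  refine ⟨⟨G, h2, fun w u hu => ?_⟩, ?_⟩
  · rcases Wedge.eq_base_or_inc s w with rfl | ⟨r, y, rfl⟩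
    · exact h2 u
    · obtain ⟨a, rfl⟩ := (hq r).isQuotientMap.surjective y
      exact (h1 r a u).trans
        ((b r).2 _ ((mem_boundary_iff (e r) _).2 (Or.inr (by simpa using hu))))
  · funext r
    refine GenLoop.ext _ _ fun t => ?_
    exact (h1 r _ _).trans (by rw [joinCube_leftCube])

/-- The adjoint map on a wedge given by a family of loops. -/
noncomputable def AdjMap.ofFamily (b : ∀ r, Ω^ (K r) Z z) : AdjMap (Wedge.base s) D z :=
  (exists_family_eq e hq b).choose

@[simp] theorem AdjMap.family_ofFamily (b : ∀ r, Ω^ (K r) Z z) :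
    (AdjMap.ofFamily e hq b).family e hq = b :=
  (exists_family_eq e hq b).choose_spec

@[simp] theorem AdjMap.ofFamily_family (k : AdjMap (Wedge.base s) D z) :
    AdjMap.ofFamily e hq (k.family e hq) = k :=
  AdjMap.ext_family e hq (AdjMap.family_ofFamily e hq _)

theorem AdjMap.map_ofFamily (ω : C(Z, Z')) (hω : ω z = z') (b : ∀ r, Ω^ (K r) Z z) :
    (AdjMap.ofFamily e hq b).map ω hω = AdjMap.ofFamily e hq fun r => mapGenLoop ω hω (b r) := by
  refine AdjMap.ext_family e hq ?_
  rw [AdjMap.family_ofFamily]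
  funext r
  conv_rhs => rw [← AdjMap.family_ofFamily e hq b]
  rfl

theorem AdjMap.mul_ofFamily (μ : C(Z × Z, Z)) (hz : μ (z, z) = z) (b b' : ∀ r, Ω^ (K r) Z z) :
    AdjMap.mul μ hz (AdjMap.ofFamily e hq b) (AdjMap.ofFamily e hq b') =
      AdjMap.ofFamily e hq fun r => mulLoop μ hz (b r) (b' r) := by
  refine AdjMap.ext_family e hq ?_
  rw [AdjMap.family_ofFamily]
  funext r
  conv_rhs => rw [← AdjMap.family_ofFamily e hq b, ← AdjMap.family_ofFamily e hq b']
  rfl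

theorem AdjMap.ofFamily_homotopic {b b' : ∀ r, Ω^ (K r) Z z}
    (h : ∀ r, GenLoop.Homotopic (b r) (b' r)) :
    (AdjMap.ofFamily e hq b).Homotopic (AdjMap.ofFamily e hq b') := by
  choose H H0 H1 Hb using fun r => exists_map_of_homotopic (h r)
  obtain ⟨G, h1, h2⟩ := Wedge.lift_prod hq (Q := (I^D) × I) (z := z)
    (fun r a => H r (a.2.2, joinCube (e r) (a.1, a.2.1))) (fun r => by fun_prop) (fun r a ha u =>
      Hb r _ _ ((mem_boundary_iff (e r) _).2 (Or.inl (by simpa using ha))))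
  have key : ∀ (b : ∀ r, Ω^ (K r) Z z) r a u, (AdjMap.ofFamily e hq b).1
      (Wedge.inc s r (q r a), u) = b r (joinCube (e r) (a, u)) := by
    intro b r a u
    conv_rhs => rw [← AdjMap.family_ofFamily e hq b]
    rw [AdjMap.family_apply, rightCube_joinCube, leftCube_joinCube]
  refine ⟨G, fun w u => ?_, fun w u => ?_, fun u _ => h2 _, fun w u hu _ => ?_⟩ <;>
    rcases Wedge.eq_base_or_inc s w with rfl | ⟨r, y, rfl⟩
  · rw [h2, (AdjMap.ofFamily e hq b).2.1]
  · obtain ⟨a, rfl⟩ := (hq r).isQuotientMap.surjective y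
    rw [h1, key, H0]
  · rw [h2, (AdjMap.ofFamily e hq b').2.1]
  · obtain ⟨a, rfl⟩ := (hq r).isQuotientMap.surjective y
    rw [h1, key, H1]
  · exact h2 _
  · obtain ⟨a, rfl⟩ := (hq r).isQuotientMap.surjective y
    rw [h1]
    exact Hb r _ _ ((mem_boundary_iff (e r) _).2 (Or.inr (by simpa using hu)))

end Family

/-! ### Adjoint maps on a suspension and loops of based maps -/

section Suspension

variable {X : Type*} [TopologicalSpace X] {x₀ : X} {D N : Type*} (e : D ⊕ Unit ≃ N)
  {Z Z' : Type*} [TopologicalSpace Z] [TopologicalSpace Z'] {z : Z} {z' : Z'}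

/-- The projection `X × I → ΣX`. -/
def Suspension.proj (x₀ : X) : C(X × I, Suspension x₀) :=
  ⟨Quotient.mk _, continuous_quotient_mk'⟩

theorem Suspension.proj_left (s : I) : Suspension.proj x₀ (x₀, s) = Suspension.base x₀ :=
  ((suspension_isCollapse x₀).eq_base_iff _).2 (Or.inl rfl)

theorem Suspension.proj_right (x : X) {s : I} (hs : s = 0 ∨ s = 1) :
    Suspension.proj x₀ (x, s) = Suspension.base x₀ :=
  ((suspension_isCollapse x₀).eq_base_iff _).2 (Or.inr hs)

theorem mem_boundary_unit {t : I^Unit} : t ∈ Cube.boundary Unit ↔ t () = 0 ∨ t () = 1 :=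
  ⟨fun ⟨_, h⟩ => h, fun h => ⟨(), h⟩⟩

/-- The loop of based maps `X → Z` given by an adjoint map on `ΣX`. -/
def AdjMap.toBased (k : AdjMap (Suspension.base x₀) D z) :
    Ω^ N (BasedMap x₀ z) (BasedMap.base x₀ z) :=
  basedLoop x₀ z
    (fun a => k.1 (Suspension.proj x₀ (a.2, rightCube e a.1 ()), leftCube e a.1)) (by fun_prop)
    (fun t ht x => by
      rcases (mem_boundary_iff e t).1 ht with h | h
      · rw [Suspension.proj_right x (mem_boundary_unit.1 h), k.2.1]
      · exact k.2.2 _ _ h)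
    (fun t => by simp only [Suspension.proj_left, k.2.1])

theorem AdjMap.toBased_apply (k : AdjMap (Suspension.base x₀) D z) (t : I^N) (x : X) :
    (k.toBased e t).1 x = k.1 (Suspension.proj x₀ (x, rightCube e t ()), leftCube e t) := rfl

theorem AdjMap.Homotopic.toBased {k k' : AdjMap (Suspension.base x₀) D z} (h : k.Homotopic k') :
    GenLoop.Homotopic (k.toBased e) (k'.toBased e) := by
  obtain ⟨H, H0, H1, Ht, Hb⟩ := h
  refine based_homotopic_of_map
    (fun a => H (Suspension.proj x₀ (a.2.2, rightCube e a.2.1 ()), leftCube e a.2.1, a.1))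
    (by fun_prop) (fun t x => H0 _ _) (fun t x => H1 _ _) (fun s t ht x => ?_) fun s t => ?_
  · rcases (mem_boundary_iff e t).1 ht with h | h
    · simp only [Suspension.proj_right x (mem_boundary_unit.1 h), Ht]
    · exact Hb _ _ h s
  · simp only [Suspension.proj_left, Ht]

theorem mem_boundary_join {s : I} {u : I^D} :
    joinCube e (fun _ => s, u) ∈ Cube.boundary N ↔ (s = 0 ∨ s = 1) ∨ u ∈ Cube.boundary D := by
  rw [mem_boundary_iff e, rightCube_joinCube, leftCube_joinCube, mem_boundary_unit]

/-- The suspension adjunction: the `Unit` coordinate of the cube becomes the suspension coordinate.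
-/
theorem exists_toBased_eq [LocallyCompactSpace X]
    (Q : Ω^ N (BasedMap x₀ z) (BasedMap.base x₀ z)) :
    ∃ k : AdjMap (Suspension.base x₀) D z, k.toBased e = Q := by
  have hQ : ∀ t ∈ Cube.boundary N, ∀ x, (Q t).1 x = z := fun t ht x =>
    congrArg (fun f : BasedMap x₀ z => f.1 x) (Q.2 t ht)
  obtain ⟨G, h1, h2⟩ := (suspension_isCollapse x₀).lift_prod (Q := I^D) (z := z)
    (fun a => (Q (joinCube e (fun _ => a.1.2, a.2))).1 a.1.1) (by fun_prop) (by
      rintro ⟨x, s⟩ (rfl | hs) u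
      · exact (Q _).2
      · exact hQ _ ((mem_boundary_join e).2 (Or.inl hs)) x)
  refine ⟨⟨G, h2, fun p u hu => ?_⟩, ?_⟩
  · obtain ⟨⟨x, s⟩, rfl⟩ := (suspension_isCollapse x₀).isQuotientMap.surjective p
    exact (h1 _ u).trans (hQ _ ((mem_boundary_join e).2 (Or.inr hu)) x)
  · refine GenLoop.ext _ _ fun t => Subtype.ext (ContinuousMap.ext fun x => ?_)
    exact (h1 (x, rightCube e t ()) _).trans
      (congrArg (fun t => (Q t).1 x) (joinCube_leftCube e t))

theorem AdjMap.homotopic_of_toBased [LocallyCompactSpace X]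
    {k k' : AdjMap (Suspension.base x₀) D z}
    (h : GenLoop.Homotopic (k.toBased e) (k'.toBased e)) : k.Homotopic k' := by
  obtain ⟨H, H0, H1, Hb⟩ := exists_map_of_homotopic h
  have hH : ∀ τ, ∀ t ∈ Cube.boundary N, ∀ x, (H (τ, t)).1 x = z := fun τ t ht x =>
    congrArg (fun f : BasedMap x₀ z => f.1 x) (Hb τ t ht)
  obtain ⟨G, h1, h2⟩ := (suspension_isCollapse x₀).lift_prod (Q := (I^D) × I) (z := z)
    (fun a => (H (a.2.2, joinCube e (fun _ => a.1.2, a.2.1))).1 a.1.1) (by fun_prop) (by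
      rintro ⟨x, s⟩ (rfl | hs) u
      · exact (H _).2
      · exact hH _ _ ((mem_boundary_join e).2 (Or.inl hs)) x)
  have key : ∀ (k : AdjMap (Suspension.base x₀) D z) x s u,
      (k.toBased e (joinCube e (fun _ => s, u))).1 x = k.1 (Suspension.proj x₀ (x, s), u) := by
    intro k x s u
    rw [AdjMap.toBased_apply, rightCube_joinCube, leftCube_joinCube]
  refine ⟨G, fun p u => ?_, fun p u => ?_, fun u s => h2 _, fun p u hu τ => ?_⟩ <;>
    obtain ⟨⟨x, s⟩, rfl⟩ := (suspension_isCollapse x₀).isQuotientMap.surjective p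
  · rw [h1, H0, key]; rfl
  · rw [h1, H1, key]; rfl
  · exact (h1 _ _).trans (hH _ _ ((mem_boundary_join e).2 (Or.inr hu)) x)

end Suspension

/-! ### Homotopy groups of spaces of based maps on a space whose suspension splits -/

section Splitting

variable {X : Type*} [TopologicalSpace X] {x₀ : X}
  {ι : Type*} {S : ι → Type*} [∀ r, TopologicalSpace (S r)] {s : ∀ r, S r}
  {D N : Type*} (e : D ⊕ Unit ≃ N) {L K : ι → Type*} (e' : ∀ r, D ⊕ L r ≃ K r)
  {q : ∀ r, C(I^(L r), S r)} (hq : ∀ r, IsCollapse (q r) (Cube.boundary (L r)) (s r))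
  (f : C(Suspension x₀, Wedge s)) (hf : f (Suspension.base x₀) = Wedge.base s)
  {Z Z' : Type*} [TopologicalSpace Z] [TopologicalSpace Z'] {z : Z} {z' : Z'}

/-- The loop of based maps given by a family of loops and a map from `ΣX` to a wedge. -/
noncomputable def familyLoop (b : ∀ r, Ω^ (K r) Z z) :
    Ω^ N (BasedMap x₀ z) (BasedMap.base x₀ z) :=
  ((AdjMap.ofFamily e' hq b).comp f hf).toBased e

theorem familyLoop_apply (b : ∀ r, Ω^ (K r) Z z) (t : I^N) (x : X) :
    (familyLoop e e' hq f hf b t).1 x = (AdjMap.ofFamily e' hq b).1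
      (f (Suspension.proj x₀ (x, rightCube e t ())), leftCube e t) := rfl

theorem familyLoop_homotopic {b b' : ∀ r, Ω^ (K r) Z z}
    (h : ∀ r, GenLoop.Homotopic (b r) (b' r)) :
    GenLoop.Homotopic (familyLoop e e' hq f hf b) (familyLoop e e' hq f hf b') :=
  ((AdjMap.ofFamily_homotopic e' hq h).comp f hf).toBased e

variable (g : C(Wedge s, Suspension x₀))

theorem exists_familyLoop_homotopic [LocallyCompactSpace X]
    (hg : g (Wedge.base s) = Suspension.base x₀)
    (hgf : (g.comp f).HomotopicRel (ContinuousMap.id _) {Suspension.base x₀})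
    (Q : Ω^ N (BasedMap x₀ z) (BasedMap.base x₀ z)) :
    ∃ b : ∀ r, Ω^ (K r) Z z, GenLoop.Homotopic (familyLoop e e' hq f hf b) Q := by
  obtain ⟨k, rfl⟩ := exists_toBased_eq e Q
  refine ⟨(k.comp g hg).family e' hq, ?_⟩
  rw [familyLoop, AdjMap.ofFamily_family]
  exact (k.comp_homotopic (f := g.comp f) ((congrArg g hf).trans hg) rfl hgf).toBased e

/-- Pulling the homotopy back along `g` and restricting to the `r`-th sphere recovers the `r`-th
loop, since f ∘ g is based homotopic to the identity. -/
theorem homotopic_of_familyLoop_homotopic [LocallyCompactSpace X]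
    (hg : g (Wedge.base s) = Suspension.base x₀)
    (hfg : (f.comp g).HomotopicRel (ContinuousMap.id _) {Wedge.base s})
    {b b' : ∀ r, Ω^ (K r) Z z}
    (h : GenLoop.Homotopic (familyLoop e e' hq f hf b) (familyLoop e e' hq f hf b')) (r : ι) :
    GenLoop.Homotopic (b r) (b' r) := by
  have h1 := ((AdjMap.homotopic_of_toBased e h).comp g hg).loop (e' r)
    ((Wedge.inc s r).comp (q r)) (hq r).inc_comp_boundary
  have h2 : ∀ b : ∀ r, Ω^ (K r) Z z, GenLoop.Homotopic
      (AdjMap.loop (e' r) ((Wedge.inc s r).comp (q r)) (hq r).inc_comp_boundary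
        (((AdjMap.ofFamily e' hq b).comp f hf).comp g hg)) (b r) := by
    intro b
    have h3 := ((AdjMap.ofFamily e' hq b).comp_homotopic (f := f.comp g)
      ((congrArg f hg).trans hf) rfl hfg).loop (e' r)
        ((Wedge.inc s r).comp (q r)) (hq r).inc_comp_boundary
    refine h3.trans ?_
    conv_rhs => rw [← AdjMap.family_ofFamily e' hq b]
    exact GenLoop.Homotopic.refl _
  exact ((h2 b).symm.trans h1).trans (h2 b')

theorem exists_loopClass_eq (β : ∀ r, HomotopyGroup (K r) Z z) :
    ∃ b : ∀ r, Ω^ (K r) Z z, (fun r => loopClass (b r)) = β := by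
  choose b hb using fun r => loopClass_surjective (β r)
  exact ⟨b, funext hb⟩

/-- The class of `familyLoop`, as a function of the classes of the members of the family. -/
noncomputable def familyClass (β : ∀ r, HomotopyGroup (K r) Z z) :
    HomotopyGroup N (BasedMap x₀ z) (BasedMap.base x₀ z) :=
  loopClass (familyLoop e e' hq f hf fun r => (loopClass_surjective (β r)).choose)

/-- Independence of the representatives chosen in `familyClass`. -/
theorem familyClass_loopClass (b : ∀ r, Ω^ (K r) Z z) :
    familyClass e e' hq f hf (fun r => loopClass (b r)) =
      loopClass (familyLoop e e' hq f hf b) :=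
  loopClass_eq_iff.2 (familyLoop_homotopic e e' hq f hf fun r =>
    loopClass_eq_iff.1 (loopClass_surjective (loopClass (b r))).choose_spec)

theorem familyClass_surjective [LocallyCompactSpace X]
    (hg : g (Wedge.base s) = Suspension.base x₀)
    (hgf : (g.comp f).HomotopicRel (ContinuousMap.id _) {Suspension.base x₀}) :
    Function.Surjective (familyClass e e' hq f hf (z := z)) := by
  intro a
  obtain ⟨Q, rfl⟩ := loopClass_surjective a
  obtain ⟨b, hb⟩ := exists_familyLoop_homotopic e e' hq f hf g hg hgf Q
  exact ⟨_, (familyClass_loopClass e e' hq f hf b).trans (loopClass_eq_iff.2 hb)⟩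

theorem familyClass_injective [LocallyCompactSpace X]
    (hg : g (Wedge.base s) = Suspension.base x₀)
    (hfg : (f.comp g).HomotopicRel (ContinuousMap.id _) {Wedge.base s}) :
    Function.Injective (familyClass e e' hq f hf (z := z)) := by
  intro β β' h
  obtain ⟨b, rfl⟩ := exists_loopClass_eq β
  obtain ⟨b', rfl⟩ := exists_loopClass_eq β'
  rw [familyClass_loopClass, familyClass_loopClass, loopClass_eq_iff] at h
  exact funext fun r => loopClass_eq_iff.2
    (homotopic_of_familyLoop_homotopic e e' hq f hf g hg hfg h r)

variable [DecidableEq N] [Nonempty N]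

/-- The class in the homotopy group of the space of all maps given by a family of classes. -/
noncomputable def freeFamilyClass (β : ∀ r, HomotopyGroup (K r) Z z) :
    HomotopyGroup N C(X, Z) (ContinuousMap.const X z) :=
  inducedHom N (BasedMap.incl x₀ z) (y := ContinuousMap.const X z) rfl (familyClass e e' hq f hf β)

theorem freeFamilyClass_loopClass (b : ∀ r, Ω^ (K r) Z z) :
    freeFamilyClass e e' hq f hf (fun r => loopClass (b r)) =
      loopClass (mapGenLoop (BasedMap.incl x₀ z) (y := ContinuousMap.const X z) rfl
        (familyLoop e e' hq f hf b)) := by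
  rw [freeFamilyClass, familyClass_loopClass]
  rfl

theorem inducedHom_evalAt_freeFamilyClass (β : ∀ r, HomotopyGroup (K r) Z z) :
    inducedHom N (evalAt Z x₀) rfl (freeFamilyClass e e' hq f hf β) = 1 := by
  obtain ⟨b, rfl⟩ := exists_loopClass_eq β
  rw [freeFamilyClass_loopClass, inducedHom_loopClass]
  exact congrArg loopClass (GenLoop.ext _ _ fun t => (familyLoop e e' hq f hf b t).2)

variable [∀ r, DecidableEq (K r)] [∀ r, Nonempty (K r)]

theorem freeFamilyClass_one :
    freeFamilyClass e e' hq f hf (fun r => (1 : HomotopyGroup (K r) Z z)) = 1 := by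
  refine (freeFamilyClass_loopClass e e' hq f hf fun r => GenLoop.const).trans ?_
  refine congrArg loopClass (GenLoop.ext _ _ fun t => ContinuousMap.ext fun x => ?_)
  change (familyLoop e e' hq f hf (fun r => GenLoop.const) t).1 x = z
  rw [familyLoop_apply]
  let k : AdjMap (Wedge.base s) D z := ⟨ContinuousMap.const _ z, fun _ => rfl, fun _ _ _ => rfl⟩
  have hk : AdjMap.ofFamily e' hq (fun r => (GenLoop.const : Ω^ (K r) Z z)) = k :=
    AdjMap.ofFamily_family e' hq k
  rw [hk]
  rfl

/-- Composition with a map, as a continuous map of mapping spaces. -/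
def postcomp (X : Type*) [TopologicalSpace X] (ω : C(Z, Z')) : C(C(X, Z), C(X, Z')) :=
  ⟨fun h => ω.comp h, ContinuousMap.continuous_postcomp ω⟩

theorem postcomp_const (X : Type*) [TopologicalSpace X] (ω : C(Z, Z')) (hω : ω z = z') :
    postcomp X ω (ContinuousMap.const X z) = ContinuousMap.const X z' :=
  ContinuousMap.ext fun _ => hω

theorem inducedHom_freeFamilyClass (ω : C(Z, Z')) (hω : ω z = z')
    (β : ∀ r, HomotopyGroup (K r) Z z) :
    inducedHom N (postcomp X ω) (postcomp_const X ω hω) (freeFamilyClass e e' hq f hf β) =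
      freeFamilyClass e e' hq f hf fun r => inducedHom (K r) ω hω (β r) := by
  obtain ⟨b, rfl⟩ := exists_loopClass_eq β
  rw [freeFamilyClass_loopClass]
  refine Eq.trans ?_ (freeFamilyClass_loopClass e e' hq f hf fun r => mapGenLoop ω hω (b r)).symm
  refine congrArg loopClass (GenLoop.ext _ _ fun t => ?_)
  refine ContinuousMap.ext fun x => ?_
  change ω ((familyLoop e e' hq f hf b t).1 x) = (familyLoop e e' hq f hf _ t).1 x
  rw [familyLoop_apply, familyLoop_apply, ← AdjMap.map_ofFamily]
  rfl

/-- The multiplication on a mapping space induced by one on the target. -/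
def mapMul (X : Type*) [TopologicalSpace X] [LocallyCompactSpace X] (μ : C(Z × Z, Z)) :
    C(C(X, Z) × C(X, Z), C(X, Z)) :=
  (ContinuousMap.mk (fun a : (C(X, Z) × C(X, Z)) × X => μ (a.1.1 a.2, a.1.2 a.2))
    (by fun_prop)).curry

/-- Products of classes are computed pointwise in the target, and pointwise products commute with
pullback along `f`. No compatibility of `f` with comultiplications is needed. -/
theorem freeFamilyClass_mul [LocallyCompactSpace X] (μ : C(Z × Z, Z)) (hl : ∀ b, μ (z, b) = b)
    (hr : ∀ b, μ (b, z) = b) (β β' : ∀ r, HomotopyGroup (K r) Z z) :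
    freeFamilyClass e e' hq f hf (fun r => β r * β' r) =
      freeFamilyClass e e' hq f hf β * freeFamilyClass e e' hq f hf β' := by
  obtain ⟨b, rfl⟩ := exists_loopClass_eq β
  obtain ⟨b', rfl⟩ := exists_loopClass_eq β'
  simp only [← loopClass_mulLoop μ hl hr]
  rw [freeFamilyClass_loopClass, freeFamilyClass_loopClass, freeFamilyClass_loopClass]
  have hl' : ∀ h, mapMul X μ (ContinuousMap.const X z, h) = h := fun h =>
    ContinuousMap.ext fun x => hl _
  have hr' : ∀ h, mapMul X μ (h, ContinuousMap.const X z) = h := fun h =>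
    ContinuousMap.ext fun x => hr _
  refine Eq.trans ?_ (loopClass_mulLoop (mapMul X μ) hl' hr' _ _)
  refine congrArg loopClass (GenLoop.ext _ _ fun t => ContinuousMap.ext fun x => ?_)
  change (familyLoop e e' hq f hf _ t).1 x =
    μ ((familyLoop e e' hq f hf b t).1 x, (familyLoop e e' hq f hf b' t).1 x)
  simp only [familyLoop_apply]
  rw [← AdjMap.mul_ofFamily]
  rfl

end Splitting

/-! ### Splitting of images on homotopy groups of mapping spaces -/

theorem nonempty_mulEquiv_of_ker_eq {G H H' : Type*} [Group G] [Group H] [Group H'] (φ : G →* H)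
    (ψ : G →* H') (hφ : Function.Surjective φ) (hψ : Function.Surjective ψ)
    (h : ∀ a, φ a = 1 ↔ ψ a = 1) : Nonempty (H ≃* H') := by
  have hk : φ.ker = ψ.ker := Subgroup.ext fun a => h a
  exact ⟨(QuotientGroup.quotientKerEquivOfSurjective φ hφ).symm.trans
    ((QuotientGroup.quotientMulEquivOfEq hk).trans
      (QuotientGroup.quotientKerEquivOfSurjective ψ hψ))⟩

section Splitting

variable {X : Type*} [TopologicalSpace X] {x₀ : X}
  {ι : Type*} {S : ι → Type*} [∀ r, TopologicalSpace (S r)] {s : ∀ r, S r}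
  {D N : Type*} (e : D ⊕ Unit ≃ N) {L K : ι → Type*} (e' : ∀ r, D ⊕ L r ≃ K r)
  {q : ∀ r, C(I^(L r), S r)} (hq : ∀ r, IsCollapse (q r) (Cube.boundary (L r)) (s r))
  (f : C(Suspension x₀, Wedge s)) (hf : f (Suspension.base x₀) = Wedge.base s)
  {Z Z' : Type*} [TopologicalSpace Z] [TopologicalSpace Z'] {z : Z} {z' : Z'}
  [DecidableEq N] [Nonempty N]

/-- The homomorphism induced by the inclusion of the constant maps. -/
noncomputable def constHom (N X : Type*) [TopologicalSpace X] [DecidableEq N] [Nonempty N]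
    (z : Z) : HomotopyGroup N Z z →* HomotopyGroup N C(X, Z) (ContinuousMap.const X z) :=
  inducedHom N ContinuousMap.const' rfl

/-- The homomorphism induced by evaluation at a point. -/
noncomputable def evalHom (N : Type*) [DecidableEq N] [Nonempty N] (x₀ : X) (z : Z) :
    HomotopyGroup N C(X, Z) (ContinuousMap.const X z) →* HomotopyGroup N Z z :=
  inducedHom N (evalAt Z x₀) rfl

theorem evalHom_constHom (a : HomotopyGroup N Z z) : evalHom N x₀ z (constHom N X z a) = a := by
  obtain ⟨p, rfl⟩ := loopClass_surjective a
  rfl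

theorem inducedHom_constHom (ω : C(Z, Z')) (hω : ω z = z') (a : HomotopyGroup N Z z) :
    inducedHom N (postcomp X ω) (postcomp_const X ω hω) (constHom N X z a) =
      constHom N X z' (inducedHom N ω hω a) := by
  obtain ⟨p, rfl⟩ := loopClass_surjective a
  rfl

/-- The class in the homotopy group of a mapping space given by a class in the homotopy group of
the target and a family of classes. -/
noncomputable def splitClass
    (a : HomotopyGroup N Z z × ∀ r, HomotopyGroup (K r) Z z) :
    HomotopyGroup N C(X, Z) (ContinuousMap.const X z) :=
  constHom N X z a.1 * freeFamilyClass e e' hq f hf a.2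

section

variable (g : C(Wedge s, Suspension x₀)) [LocallyCompactSpace X]

theorem splitClass_surjective [T2Space X] (hX : WellPointed x₀)
    (hg : g (Wedge.base s) = Suspension.base x₀)
    (hgf : (g.comp f).HomotopicRel (ContinuousMap.id _) {Suspension.base x₀}) :
    Function.Surjective (splitClass e e' hq f hf (z := z)) := by
  intro c
  let a := evalHom N x₀ z c
  -- Dividing `c` by its constant part kills its evaluation at `x₀`, so the quotient comes from
  -- based maps.
  obtain ⟨b, hb⟩ := exists_inducedHom_incl_eq hX ((constHom N X z a)⁻¹ * c) (by
    change evalHom N x₀ z _ = 1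
    rw [map_mul, map_inv, evalHom_constHom, inv_mul_cancel])
  obtain ⟨β, rfl⟩ := familyClass_surjective e e' hq f hf g hg hgf b
  refine ⟨(a, β), ?_⟩
  change constHom N X z a * freeFamilyClass e e' hq f hf β = c
  rw [show freeFamilyClass e e' hq f hf β = (constHom N X z a)⁻¹ * c from hb, mul_inv_cancel_left]

end

variable [∀ r, DecidableEq (K r)] [∀ r, Nonempty (K r)]

theorem inducedHom_splitClass (ω : C(Z, Z')) (hω : ω z = z')
    (a : HomotopyGroup N Z z × ∀ r, HomotopyGroup (K r) Z z) :
    inducedHom N (postcomp X ω) (postcomp_const X ω hω) (splitClass e e' hq f hf a) =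
      splitClass e e' hq f hf
        (inducedHom N ω hω a.1, fun r => inducedHom (K r) ω hω (a.2 r)) := by
  rw [splitClass, map_mul, inducedHom_constHom, inducedHom_freeFamilyClass e e' hq f hf ω hω]
  rfl

theorem splitClass_one :
    splitClass e e' hq f hf (1 : HomotopyGroup N Z z × ∀ r, HomotopyGroup (K r) Z z) = 1 := by
  refine (congrArg₂ (· * ·) (map_one (constHom N X z)) ?_).trans (mul_one 1)
  exact freeFamilyClass_one e e' hq f hf

variable (g : C(Wedge s, Suspension x₀)) [LocallyCompactSpace X]

/-- Needed for a target without multiplication, where `splitClass` may fail to be a homomorphism.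
Evaluation at `x₀` isolates the first component; the family is then compared with the trivial one
through injectivity of `familyClass`. -/
theorem eq_one_of_splitClass_eq_one [T2Space X] (hX : WellPointed x₀)
    (hg : g (Wedge.base s) = Suspension.base x₀)
    (hfg : (f.comp g).HomotopicRel (ContinuousMap.id _) {Wedge.base s})
    (a : HomotopyGroup N Z z × ∀ r, HomotopyGroup (K r) Z z)
    (ha : splitClass e e' hq f hf a = 1) : a = 1 := by
  obtain ⟨a, β⟩ := a
  change constHom N X z a * freeFamilyClass e e' hq f hf β = 1 at ha
  have h1 : a = 1 := by
    have := congrArg (evalHom N x₀ z) ha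
    rw [map_mul, evalHom_constHom, map_one] at this
    rwa [show evalHom N x₀ z (freeFamilyClass e e' hq f hf β) = 1 from
      inducedHom_evalAt_freeFamilyClass e e' hq f hf β, mul_one] at this
  subst h1
  rw [map_one, one_mul] at ha
  have h2 : β = 1 := familyClass_injective e e' hq f hf g hg hfg
    (inducedHom_incl_injective (N := N) (z := z) hX
      (ha.trans (freeFamilyClass_one e e' hq f hf).symm))
  rw [h2]
  rfl

/-- The splitting homomorphism, if the target has a strictly unital multiplication. -/
noncomputable def splitHom (μ : C(Z × Z, Z)) (hl : ∀ b, μ (z, b) = b) (hr : ∀ b, μ (b, z) = b) :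
    (HomotopyGroup N Z z × ∀ r, HomotopyGroup (K r) Z z) →*
      HomotopyGroup N C(X, Z) (ContinuousMap.const X z) :=
  MonoidHom.mk' (splitClass e e' hq f hf) fun a b => by
    change constHom N X z (a.1 * b.1) * freeFamilyClass e e' hq f hf (fun r => a.2 r * b.2 r) =
      (_ * _) * (_ * _)
    rw [freeFamilyClass_mul e e' hq f hf μ hl hr, map_mul]
    -- Commutativity is needed to exchange the two middle factors; the mapping space inherits a
    -- strict unit from `Z`.
    have hc := homotopyGroup_mul_comm (N := N) (e := ContinuousMap.const X z) (mapMul X μ)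
      (fun h => ContinuousMap.ext fun x => hl _) (fun h => ContinuousMap.ext fun x => hr _)
    rw [mul_assoc, mul_assoc, ← mul_assoc (constHom N X z b.1),
      hc (constHom N X z b.1) (freeFamilyClass e e' hq f hf a.2), mul_assoc]

/-- Only `Z` carries a multiplication. Both sides are quotients of the same group π(Z) × ∏ π(Z), and
naturality with `eq_one_of_splitClass_eq_one` for `Z'` identifies the kernels. -/
theorem nonempty_range_mulEquiv [T2Space X] (hX : WellPointed x₀)
    (e : D ⊕ Unit ≃ N) (e' : ∀ r, D ⊕ L r ≃ K r)
    (hq : ∀ r, IsCollapse (q r) (Cube.boundary (L r)) (s r))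
    (hf : f (Suspension.base x₀) = Wedge.base s)
    (hg : g (Wedge.base s) = Suspension.base x₀)
    (hgf : (g.comp f).HomotopicRel (ContinuousMap.id _) {Suspension.base x₀})
    (hfg : (f.comp g).HomotopicRel (ContinuousMap.id _) {Wedge.base s})
    (μ : C(Z × Z, Z)) (hl : ∀ b, μ (z, b) = b) (hr : ∀ b, μ (b, z) = b) (ω : C(Z, Z'))
    (hω : ω z = z') :
    Nonempty ((inducedHom N (postcomp X ω) (postcomp_const X ω hω)).range ≃*
      (inducedHom N ω hω).range × ∀ r, (inducedHom (K r) ω hω).range) := by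
  let Ψ := splitHom e e' hq f hf μ hl hr
  have hΨ : Function.Surjective Ψ := splitClass_surjective e e' hq f hf g hX hg hgf
  let φ := (inducedHom N (postcomp X ω) (postcomp_const X ω hω)).rangeRestrict.comp Ψ
  let ψ : (HomotopyGroup N Z z × ∀ r, HomotopyGroup (K r) Z z) →*
      (inducedHom N ω hω).range × ∀ r, (inducedHom (K r) ω hω).range :=
    MonoidHom.prodMap (inducedHom N ω hω).rangeRestrict
      (MonoidHom.piMap fun r => (inducedHom (K r) ω hω).rangeRestrict)
  refine nonempty_mulEquiv_of_ker_eq φ ψ ?_ ?_ ?_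
  · exact (MonoidHom.rangeRestrict_surjective _).comp hΨ
  · exact (MonoidHom.rangeRestrict_surjective _).prodMap
      (Function.Surjective.piMap fun r => MonoidHom.rangeRestrict_surjective _)
  · intro a
    have h1 : φ a = 1 ↔ splitClass e e' hq f hf
        (inducedHom N ω hω a.1, fun r => inducedHom (K r) ω hω (a.2 r)) = 1 := by
      rw [← inducedHom_splitClass]
      exact Subtype.ext_iff
    have h2 : ψ a = 1 ↔ (inducedHom N ω hω a.1, fun r => inducedHom (K r) ω hω (a.2 r)) =
        (1 : HomotopyGroup N Z' z' × ∀ r, HomotopyGroup (K r) Z' z') := by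
      simp only [ψ, Prod.ext_iff, funext_iff, Subtype.ext_iff]
      rfl
    rw [h1, h2]
    constructor
    · exact eq_one_of_splitClass_eq_one e e' hq f hf g hX hg hfg _
    · intro h
      rw [h, splitClass_one]

end Splitting

/-! ### Gottlieb groups as images of homotopy groups of mapping spaces -/

theorem map_range_inducedHom {N U U' V V' : Type*} [DecidableEq N] [Nonempty N]
    [TopologicalSpace U] [TopologicalSpace U'] [TopologicalSpace V] [TopologicalSpace V']
    {u : U} {u' : U'} {v : V} {v' : V'} (a : C(U, V)) (ha : a u = v) (a' : C(U', V'))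
    (ha' : a' u' = v') (h : C(U, U')) (hh : h u = u') (k : C(V, V')) (hk : k v = v')
    (hc : ∀ x, k (a x) = a' (h x)) (hs : Function.Surjective (inducedHom N h hh)) :
    (inducedHom N a ha).range.map (inducedHom N k hk) = (inducedHom N a' ha').range := by
  have key : ∀ b, inducedHom N k hk (inducedHom N a ha b) =
      inducedHom N a' ha' (inducedHom N h hh b) := by
    intro b
    obtain ⟨p, rfl⟩ := loopClass_surjective b
    exact congrArg loopClass (GenLoop.ext _ _ fun t => hc _)
  ext c
  constructor
  · rintro ⟨_, ⟨b, rfl⟩, rfl⟩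
    exact ⟨_, (key b).symm⟩
  · rintro ⟨b', rfl⟩
    obtain ⟨b, rfl⟩ := hs b'
    exact ⟨_, ⟨b, rfl⟩, key b⟩

theorem nonempty_range_mulEquiv_of_homeomorph {N U U' V V' : Type*} [DecidableEq N] [Nonempty N]
    [TopologicalSpace U] [TopologicalSpace U'] [TopologicalSpace V] [TopologicalSpace V']
    {u : U} {u' : U'} {v : V} {v' : V'} (a : C(U, V)) (ha : a u = v) (a' : C(U', V'))
    (ha' : a' u' = v') (h : U ≃ₜ U') (hh : h u = u') (k : V ≃ₜ V') (hk : k v = v')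
    (hc : ∀ x, k (a x) = a' (h x)) :
    Nonempty ((inducedHom N a ha).range ≃* (inducedHom N a' ha').range) := by
  have hs : Function.Surjective (inducedHom N (h : C(U, U')) hh) := fun b =>
    ⟨inducedHom N (h.symm : C(U', U)) (h.symm_apply_eq.2 hh.symm) b, by
      obtain ⟨p, rfl⟩ := loopClass_surjective b
      exact congrArg loopClass (GenLoop.ext _ _ fun t => h.apply_symm_apply _)⟩
  have hi : Function.Injective (inducedHom N (k : C(V, V')) hk) :=
    Function.LeftInverse.injective
      (g := inducedHom N (k.symm : C(V', V)) (k.symm_apply_eq.2 hk.symm)) fun b => by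
      obtain ⟨p, rfl⟩ := loopClass_surjective b
      exact congrArg loopClass (GenLoop.ext _ _ fun t => k.symm_apply_apply _)
  rw [← map_range_inducedHom a ha a' ha' h hh k hk hc hs]
  exact ⟨Subgroup.equivMapOfInjective _ _ hi⟩

/-- Contraction of a cube to its vertex `0`. -/
def cubeContract {N : Type*} (τ : I) (t : I^N) : I^N := fun i => τ * t i

theorem cubeContract_one {N : Type*} (t : I^N) : cubeContract 1 t = t :=
  funext fun _ => one_mul _

/-- Contracting the cube to its vertex 0, a boundary point as `N` is nonempty, connects q t to `c`.
So loops in a full mapping space lie in the component of their base point, and restricting to that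
component costs nothing. -/
theorem loop_homotopic_base {N X Z : Type*} [Nonempty N] [TopologicalSpace X]
    [LocallyCompactSpace X] [TopologicalSpace Z] {c : C(X, Z)} (q : Ω^ N C(X, Z) c) (t : I^N) :
    (q t).Homotopic c :=
  .symm ⟨{  toFun := fun a => q (cubeContract a.1 t) a.2
            continuous_toFun := by unfold cubeContract; fun_prop
            map_zero_left := fun x => congrArg (fun f : C(X, Z) => f x) (q.2 _
              ⟨Classical.arbitrary N, Or.inl (zero_mul _)⟩)
            map_one_left := fun x => by rw [cubeContract_one] }⟩

section

variable {X : Type u} {Y : Type v} [TopologicalSpace X] [TopologicalSpace Y] (y₀ : Y)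

/-- The inclusion of the null-homotopic maps in all maps. -/
def NullMap.incl (X : Type u) [TopologicalSpace X] (y₀ : Y) : C(NullMap X y₀, C(X, Y)) :=
  ⟨Subtype.val, continuous_subtype_val⟩

theorem inducedHom_nullMap_incl_injective [LocallyCompactSpace X] (N : Type*)
    [DecidableEq N] [Nonempty N] :
    Function.Injective (inducedHom N (x := NullMap.base X y₀) (NullMap.incl X y₀)
      (y := ContinuousMap.const X y₀) rfl) := by
  intro a b h
  obtain ⟨p, rfl⟩ := loopClass_surjective a
  obtain ⟨q, rfl⟩ := loopClass_surjective b
  obtain ⟨H, H0, H1, Hb⟩ := exists_map_of_homotopic (loopClass_eq_iff.1 h)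
  have hH : ∀ a, (H a).Homotopic (ContinuousMap.const X y₀) := fun a =>
    loop_homotopic_base (N := N) ⟨⟨fun t => H (a.1, t), by fun_prop⟩, Hb a.1⟩ a.2
  exact loopClass_eq_iff.2 (homotopic_of_map (fun a => ⟨H a, hH a⟩)
    (H.continuous.subtype_mk _) (fun t => Subtype.ext (H0 t)) (fun t => Subtype.ext (H1 t))
    fun s t ht => Subtype.ext (Hb s t ht))

theorem const_homotopic_const [PathConnectedSpace Y] (X : Type u) [TopologicalSpace X]
    (y y₀ : Y) : (ContinuousMap.const X y).Homotopic (ContinuousMap.const X y₀) := by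
  obtain ⟨γ⟩ := PathConnectedSpace.joined y y₀
  exact ⟨⟨⟨fun a => γ a.1, by fun_prop⟩, fun _ => γ.source, fun _ => γ.target⟩⟩

/-- The inclusion of the constant maps. -/
def NullMap.const [PathConnectedSpace Y] (X : Type u) [TopologicalSpace X] (y₀ : Y) :
    C(Y, NullMap X y₀) :=
  ⟨fun y => ⟨ContinuousMap.const X y, const_homotopic_const X y y₀⟩,
    ContinuousMap.continuous_const'.subtype_mk _⟩

variable [LocallyCompactSpace Y] (n : ℕ) [NeZero n]

theorem gottliebGroup_eq_range : gottliebGroup n Y y₀ =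
    (inducedHom (Fin n) (x := ContinuousMap.id Y) (evalAt Y y₀) (y := y₀) rfl).range := by
  ext c
  constructor
  · rintro ⟨b, rfl⟩
    obtain ⟨p, rfl⟩ := loopClass_surjective b
    exact ⟨loopClass (mapGenLoop ⟨Subtype.val, continuous_subtype_val⟩ rfl p), rfl⟩
  · rintro ⟨b, rfl⟩
    obtain ⟨q, rfl⟩ := loopClass_surjective b
    refine ⟨loopClass ⟨⟨fun t => ⟨q t, loop_homotopic_base q t⟩,
      (map_continuous q).subtype_mk _⟩, fun t ht => Subtype.ext (q.2 t ht)⟩, rfl⟩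

variable [LocallyCompactSpace X]

/-- Restriction to constant maps gives one inclusion, the pointwise action of maps X → C(Y, Y) the
other. Path-connectedness of `Y` puts all constant maps in `NullMap X y₀`. -/
theorem map_gottliebGroup_nullMap [PathConnectedSpace Y] :
    (gottliebGroup n (NullMap X y₀) (NullMap.base X y₀)).map (inducedHom (Fin n)
      (NullMap.incl X y₀) (y := ContinuousMap.const X y₀) rfl) =
    (inducedHom (Fin n) (x := ContinuousMap.const X (ContinuousMap.id Y))
      (postcomp X (evalAt Y y₀)) (y := ContinuousMap.const X y₀) rfl).range := by
  ext c
  constructor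
  · rintro ⟨_, ⟨b, rfl⟩, rfl⟩
    obtain ⟨p, rfl⟩ := loopClass_surjective b
    let P : C((I^(Fin n)) , C(Y, NullMap X y₀)) :=
      ⟨fun t => (p t).1.comp (NullMap.const X y₀), (ContinuousMap.continuous_precomp _).comp
        (continuous_subtype_val.comp (map_continuous p))⟩
    let K : C(((I^(Fin n)) × X) × Y, Y) := ⟨fun a => (P a.1.1 a.2).1 a.1.2, by fun_prop⟩
    refine ⟨loopClass ⟨K.curry.curry, fun t ht => ?_⟩, rfl⟩
    refine ContinuousMap.ext fun x => ContinuousMap.ext fun y => ?_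
    exact congrArg (fun φ : Aut₁ (NullMap X y₀) => (φ.1 (NullMap.const X y₀ y)).1 x) (p.2 t ht)
  · rintro ⟨b, rfl⟩
    obtain ⟨q, rfl⟩ := loopClass_surjective b
    -- The pointwise action (t, m) ↦ (x ↦ q t x (m x)); on the constant map at `y₀` it returns the
    -- evaluation of `q` at `y₀`.
    let A : C(((I^(Fin n)) × NullMap X y₀) × X, Y) :=
      ⟨fun a => q a.1.1 a.2 (a.1.2.1 a.2), by fun_prop⟩
    have hq : ∀ t ∈ Cube.boundary (Fin n), ∀ x y, q t x y = y := fun t ht x y =>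
      congrArg (fun φ : C(X, C(Y, Y)) => φ x y) (q.2 t ht)
    have h0 : ∀ t, cubeContract (N := Fin n) 0 t ∈ Cube.boundary (Fin n) := fun t =>
      ⟨0, Or.inl (zero_mul _)⟩
    have hA : ∀ t m, (A.curry (t, m)).Homotopic m.1 := fun t m => .symm
      ⟨{  toFun := fun a => A ((cubeContract a.1 t, m), a.2)
          continuous_toFun := by unfold cubeContract; fun_prop
          map_zero_left := fun x => hq _ (h0 t) x _
          map_one_left := fun x => by simp only [cubeContract_one]; rfl }⟩
    let M : C((I^(Fin n)) × NullMap X y₀, NullMap X y₀) :=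
      ⟨fun a => ⟨A.curry a, (hA a.1 a.2).trans a.2.2⟩, A.curry.continuous.subtype_mk _⟩
    have hM : ∀ t ∈ Cube.boundary (Fin n), ∀ m, M (t, m) = m := fun t ht m =>
      Subtype.ext (ContinuousMap.ext fun x => hq t ht x _)
    -- `NullMap X y₀` need not be locally compact, so `loop_homotopic_base` is unavailable; the cube
    -- is contracted in the adjoint map `M` instead.
    have hM' : ∀ t, (M.curry t).Homotopic (ContinuousMap.id _) := fun t => .symm
      ⟨{  toFun := fun a => M (cubeContract a.1 t, a.2)
          continuous_toFun := by unfold cubeContract; fun_prop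
          map_zero_left := fun m => hM _ (h0 t) m
          map_one_left := fun m => by simp only [cubeContract_one]; rfl }⟩
    exact ⟨_, ⟨loopClass ⟨⟨fun t => ⟨M.curry t, hM' t⟩, M.curry.continuous.subtype_mk _⟩,
      fun t ht => Subtype.ext (ContinuousMap.ext fun m => hM t ht m)⟩, rfl⟩, rfl⟩

theorem nonempty_gottliebGroup_nullMap_mulEquiv [PathConnectedSpace Y] :
    Nonempty (gottliebGroup n (NullMap X y₀) (NullMap.base X y₀) ≃*
      (inducedHom (Fin n) (x := ContinuousMap.const X (ContinuousMap.id Y))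
        (postcomp X (evalAt Y y₀)) (y := ContinuousMap.const X y₀) rfl).range) := by
  rw [← map_gottliebGroup_nullMap]
  exact ⟨Subgroup.equivMapOfInjective _ _ (inducedHom_nullMap_incl_injective y₀ (Fin n))⟩

end

/-- Composition of self-maps. -/
def compMul (Y : Type*) [TopologicalSpace Y] [LocallyCompactSpace Y] :
    C(C(Y, Y) × C(Y, Y), C(Y, Y)) :=
  ⟨fun a => a.2.comp a.1, ContinuousMap.continuous_comp'⟩

/-! ### The sphere as a quotient of the cube -/

section Sphere

variable {m : ℕ}

/-- The map of the ball onto the sphere that collapses the boundary, as a map of Euclidean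
spaces. -/
noncomputable def ballToSphere (v : EuclideanSpace ℝ (Fin m)) :
    EuclideanSpace ℝ (Fin (m + 1)) :=
  WithLp.toLp 2 (Fin.cons (2 * ‖v‖ ^ 2 - 1) fun i => 2 * √(1 - ‖v‖ ^ 2) * v i)

@[simp] theorem ballToSphere_zero (v : EuclideanSpace ℝ (Fin m)) :
    ballToSphere v 0 = 2 * ‖v‖ ^ 2 - 1 := rfl

@[simp] theorem ballToSphere_succ (v : EuclideanSpace ℝ (Fin m)) (i : Fin m) :
    ballToSphere v i.succ = 2 * √(1 - ‖v‖ ^ 2) * v i := rfl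

theorem continuous_ballToSphere : Continuous (ballToSphere (m := m)) := by
  refine (PiLp.continuous_toLp 2 _).comp (continuous_pi fun i => ?_)
  refine Fin.cases ?_ (fun i => ?_) i
  · simp only [Fin.cons_zero]; fun_prop
  · simp only [Fin.cons_succ]; fun_prop

/-- With r = ‖v‖ this is (2r² - 1)² + 4r²(1 - r²) = 1. -/
theorem norm_ballToSphere {v : EuclideanSpace ℝ (Fin m)} (hv : ‖v‖ ≤ 1) :
    ‖ballToSphere v‖ = 1 := by
  have h1 : 0 ≤ 1 - ‖v‖ ^ 2 := by nlinarith [norm_nonneg v]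
  have h2 : ‖ballToSphere v‖ ^ 2 = 1 := by
    rw [EuclideanSpace.real_norm_sq_eq, Fin.sum_univ_succ]
    simp only [ballToSphere_zero, ballToSphere_succ, mul_pow, Real.sq_sqrt h1]
    rw [← Finset.mul_sum, ← EuclideanSpace.real_norm_sq_eq]
    ring
  exact (pow_eq_one_iff_of_nonneg (norm_nonneg _) two_ne_zero).1 h2

theorem ballToSphere_eq_single_iff {v : EuclideanSpace ℝ (Fin m)} :
    ballToSphere v = EuclideanSpace.single 0 1 ↔ ‖v‖ = 1 := by
  constructor
  · intro h
    have := congrArg (fun y : EuclideanSpace ℝ (Fin (m + 1)) => y 0) h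
    simp at this
    have h2 : ‖v‖ ^ 2 = 1 := by linarith
    exact (pow_eq_one_iff_of_nonneg (norm_nonneg _) two_ne_zero).1 h2
  · intro h
    ext i
    refine Fin.cases ?_ (fun i => ?_) i
    · simp [h]; norm_num
    · simp [h]

theorem eq_of_ballToSphere_eq {v v' : EuclideanSpace ℝ (Fin m)} (hv : ‖v‖ < 1)
    (h : ballToSphere v = ballToSphere v') : v = v' := by
  have h0 := congrArg (fun y : EuclideanSpace ℝ (Fin (m + 1)) => y 0) h
  simp only [ballToSphere_zero] at h0
  have hn : ‖v‖ ^ 2 = ‖v'‖ ^ 2 := by linarith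
  have hs : 0 < √(1 - ‖v‖ ^ 2) := Real.sqrt_pos.2 (by nlinarith [norm_nonneg v])
  ext i
  have h1 := congrArg (fun y : EuclideanSpace ℝ (Fin (m + 1)) => y i.succ) h
  simp only [ballToSphere_succ, ← hn] at h1
  exact mul_left_cancel₀ (by positivity) h1

theorem exists_ballToSphere_eq {y : EuclideanSpace ℝ (Fin (m + 1))} (hy : ‖y‖ = 1)
    (h0 : y 0 < 1) : ∃ v : EuclideanSpace ℝ (Fin m), ‖v‖ ≤ 1 ∧ ballToSphere v = y := by
  -- The first coordinate of a preimage forces ‖v‖² = (1 + y₀)/2, so this root is √(1 - ‖v‖²), the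
  -- factor by which the other coordinates must be divided.
  have hr : 0 < √((1 - y 0) / 2) := Real.sqrt_pos.2 (by linarith)
  have hr2 : √((1 - y 0) / 2) ^ 2 = (1 - y 0) / 2 := Real.sq_sqrt (by linarith)
  have hsum : ∑ i : Fin m, y i.succ ^ 2 = 1 - y 0 ^ 2 := by
    have := EuclideanSpace.real_norm_sq_eq y
    rw [hy, Fin.sum_univ_succ] at this
    linarith
  set r := √((1 - y 0) / 2) with hrdef
  let v : EuclideanSpace ℝ (Fin m) := WithLp.toLp 2 fun i => y i.succ / (2 * r)
  have hv : ‖v‖ ^ 2 = (1 + y 0) / 2 := by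
    rw [EuclideanSpace.real_norm_sq_eq]
    simp only [v, div_pow, mul_pow]
    rw [← Finset.sum_div, hsum, hr2]
    have : 1 - y 0 ≠ 0 := by linarith
    field_simp
    ring
  refine ⟨v, ?_, ?_⟩
  · nlinarith [norm_nonneg v]
  · ext i
    refine Fin.cases ?_ (fun i => ?_) i
    · rw [ballToSphere_zero, hv]; ring
    · rw [ballToSphere_succ, hv, show 1 - (1 + y 0) / 2 = (1 - y 0) / 2 by ring, ← hrdef]
      simp only [v]
      field_simp

/-- The inclusion of the unit cube in Euclidean space. -/
noncomputable def cubeIncl (t : I^(Fin m)) : EuclideanSpace ℝ (Fin m) :=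
  WithLp.toLp 2 fun i => (t i : ℝ)

/-- The cube is a bounded convex body with nonempty interior, so a homeomorphism of the whole space
takes it to the unit ball and interior to interior. -/
theorem exists_cube_homeomorph (m : ℕ) :
    ∃ h : EuclideanSpace ℝ (Fin m) ≃ₜ EuclideanSpace ℝ (Fin m),
      (∀ t, ‖h (cubeIncl t)‖ ≤ 1) ∧ (∀ t, ‖h (cubeIncl t)‖ = 1 ↔ t ∈ Cube.boundary (Fin m)) ∧
      ∀ v, ‖v‖ ≤ 1 → ∃ t, h (cubeIncl t) = v := by
  let ε := EuclideanSpace.equiv (Fin m) ℝ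
  let s : Set (EuclideanSpace ℝ (Fin m)) := ε ⁻¹' Set.pi Set.univ fun _ => Set.Icc 0 1
  have hi : interior s = ε ⁻¹' Set.pi Set.univ fun _ => Set.Ioo 0 1 := by
    have := ε.toHomeomorph.preimage_interior (Set.pi Set.univ fun _ => Set.Icc (0 : ℝ) 1)
    rw [interior_pi_set Set.finite_univ] at this
    simp only [interior_Icc] at this
    exact this.symm
  have hcl : IsClosed s :=
    (isClosed_set_pi fun _ _ => isClosed_Icc).preimage ε.continuous
  have hconv : Convex ℝ s :=
    (convex_pi fun _ _ => convex_Icc (0 : ℝ) 1).linear_preimage ε.toLinearEquiv.toLinearMap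
  have hne : (interior s).Nonempty := by
    rw [hi]
    exact ⟨ε.symm fun _ => 1 / 2, fun i _ => by simp; norm_num⟩
  have hb : Bornology.IsBounded s := by
    have hc : IsCompact s := ε.toHomeomorph.isCompact_preimage.2
      (isCompact_univ_pi fun _ => isCompact_Icc)
    exact hc.isBounded
  obtain ⟨h, h1, h2, h3⟩ := exists_homeomorph_image_interior_closure_frontier_eq_unitBall
    hconv hne hb
  rw [hcl.closure_eq] at h2
  have hs : ∀ t, cubeIncl t ∈ s := fun t i _ => (t i).2
  have hs' : ∀ t, cubeIncl t ∈ interior s ↔ t ∉ Cube.boundary (Fin m) := by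
    intro t
    rw [hi]
    simp only [Cube.boundary, Set.mem_ofPred_eq, not_exists, not_or]
    constructor
    · intro ht i
      have := ht i trivial
      exact ⟨fun h => this.1.ne' (congrArg Subtype.val h),
        fun h => this.2.ne (congrArg Subtype.val h)⟩
    · intro ht i _
      exact ⟨lt_of_le_of_ne (t i).2.1 fun h => (ht i).1 (Subtype.ext h.symm),
        lt_of_le_of_ne (t i).2.2 fun h => (ht i).2 (Subtype.ext h)⟩
  have hle : ∀ t, ‖h (cubeIncl t)‖ ≤ 1 := fun t => by
    have : h (cubeIncl t) ∈ Metric.closedBall 0 1 := h2 ▸ Set.mem_image_of_mem h (hs t)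
    simpa using this
  have hlt : ∀ t, ‖h (cubeIncl t)‖ < 1 ↔ t ∉ Cube.boundary (Fin m) := fun t => by
    rw [← hs', ← h.injective.mem_set_image (s := interior s), h1, mem_ball_zero_iff]
  refine ⟨h, hle, fun t => ?_, fun v hv => ?_⟩
  · have := hlt t
    have h' := hle t
    constructor
    · intro he
      by_contra hb
      exact (this.2 hb).ne he
    · intro hb
      exact le_antisymm h' (not_lt.1 fun hl => this.1 hl hb)
  · have : v ∈ h '' s := by rw [h2]; simpa using hv
    obtain ⟨w, hw, rfl⟩ := this
    exact ⟨fun i => ⟨w i, hw i trivial⟩, rfl⟩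

theorem exists_isCollapse_sphere (m : ℕ) [NeZero m] :
    ∃ q : C(I^(Fin m), Sphere m), IsCollapse q (Cube.boundary (Fin m)) (Sphere.base m) := by
  obtain ⟨h, h1, h2, h3⟩ := exists_cube_homeomorph m
  have hc : Continuous (cubeIncl (m := m)) := by
    refine (PiLp.continuous_toLp 2 _).comp (by fun_prop)
  have hn : ∀ t, ballToSphere (h (cubeIncl t)) ∈ Metric.sphere 0 1 := fun t => by
    simpa using norm_ballToSphere (h1 t)
  let q : C(I^(Fin m), Sphere m) := ⟨fun t => ⟨ballToSphere (h (cubeIncl t)), hn t⟩,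
      (continuous_ballToSphere.comp (h.continuous.comp hc)).subtype_mk _⟩
  have hbase : ∀ t, q t = Sphere.base m ↔ t ∈ Cube.boundary (Fin m) := fun t => by
    rw [← h2, ← ballToSphere_eq_single_iff]
    exact Subtype.ext_iff
  have hinj : Function.Injective (cubeIncl (m := m)) := fun t t' htt => by
    funext i
    exact Subtype.ext (congrArg (fun y : EuclideanSpace ℝ (Fin m) => y i) htt)
  have hsurj : Function.Surjective q := by
    rintro ⟨y, hy⟩
    have hy' : ‖y‖ = 1 := by simpa using hy
    by_cases h0 : y 0 < 1
    · obtain ⟨v, hv, rfl⟩ := exists_ballToSphere_eq hy' h0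
      obtain ⟨t, rfl⟩ := h3 v hv
      exact ⟨t, rfl⟩
    -- A unit vector with first coordinate at least 1 is the base point, which is the image of the
    -- vertex 0.
    · refine ⟨fun _ => 0, ((hbase _).2 ⟨0, Or.inl rfl⟩).trans (Subtype.ext ?_)⟩
      have hsum := EuclideanSpace.real_norm_sq_eq y
      rw [hy', Fin.sum_univ_succ] at hsum
      have hnn : 0 ≤ ∑ i : Fin m, y i.succ ^ 2 := Finset.sum_nonneg fun i _ => sq_nonneg _
      have hy0 : y 0 = 1 := by nlinarith
      have hz : ∑ i : Fin m, y i.succ ^ 2 = 0 := by rw [hy0] at hsum; linarith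
      rw [Finset.sum_eq_zero_iff_of_nonneg fun i _ => sq_nonneg _] at hz
      ext i
      refine Fin.cases ?_ (fun i => ?_) i
      · simp [Sphere.base, hy0]
      · have := hz i (Finset.mem_univ i)
        simpa [Sphere.base] using (pow_eq_zero_iff two_ne_zero).1 this |>.symm
  refine ⟨q, ⟨Topology.IsQuotientMap.of_surjective_continuous hsurj q.continuous, hbase, ?_⟩⟩
  intro t t' htt
  by_cases ht : t ∈ Cube.boundary (Fin m)
  · exact Or.inr ht
  · refine Or.inl (hinj (h.injective (eq_of_ballToSphere_eq ?_ (congrArg Subtype.val htt))))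
    exact lt_of_le_of_ne (h1 t) fun hh => ht ((h2 t).1 hh)

end Sphere

/-! ### The circle -/

theorem exists_isCollapse_circle :
    ∃ c : C(I, Sphere 1), IsCollapse c {u : I | u = 0 ∨ u = 1} (Sphere.base 1) := by
  obtain ⟨q, hq⟩ := exists_isCollapse_sphere 1
  let c : C(I, Sphere 1) := ⟨fun u => q fun _ => u, by fun_prop⟩
  refine ⟨c, Topology.IsQuotientMap.of_surjective_continuous ?_ c.continuous, ?_, ?_⟩
  · intro y
    obtain ⟨t, rfl⟩ := hq.isQuotientMap.surjective y
    exact ⟨t 0, congrArg q (funext fun i => congrArg t (Subsingleton.elim _ _))⟩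
  · intro u
    refine (hq.eq_base_iff _).trans ⟨fun ⟨_, h⟩ => h, fun h => ⟨0, h⟩⟩
  · intro u u' h
    rcases hq.eq_or_mem _ _ h with h | ⟨_, h⟩
    · exact Or.inl (congrFun h 0)
    · exact Or.inr h

/-- The circle is cut open at the base point. At time `t` the loop `f` is squeezed into [t/4, 1 -
t/4], and the freed ends run along `h`. -/
theorem wellPointed_circle : WellPointed (Sphere.base 1) := by
  intro Z _ f h h0
  obtain ⟨c, hc⟩ := exists_isCollapse_circle
  let pr : ℝ → I := Set.projIcc 0 1 zero_le_one
  have hpr : Continuous pr := continuous_projIcc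
  have pr0 : ∀ x, x ≤ 0 → pr x = 0 := fun x hx => Set.projIcc_of_le_left _ hx
  have pr1 : ∀ x, 1 ≤ x → pr x = 1 := fun x hx => Set.projIcc_of_right_le _ hx
  have prI : ∀ x : I, pr x = x := fun x => Set.projIcc_val _ x
  -- `d` is nonpositive exactly on u ∈ [t/4, 1 - t/4] and equals t at both ends of I; `φ` rescales
  -- that interval affinely onto [0, 1].
  let d : I × I → ℝ := fun a => max (a.2 - 4 * a.1 : ℝ) (a.2 - 4 * (1 - a.1))
  let φ : I × I → ℝ := fun a => (4 * a.1 - a.2) / (4 - 2 * a.2)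
  have hne : ∀ t : I, 0 < (4 - 2 * t : ℝ) := fun t => by linarith [t.2.2]
  have hφ : Continuous φ :=
    Continuous.div (by fun_prop) (by fun_prop) fun a => (hne a.2).ne'
  have hend : ∀ u : I, u = 0 ∨ u = 1 → f (c u) = h 0 := fun u hu => by
    rw [(hc.eq_base_iff u).2 hu, h0]
  let G : I × I → Z := fun a => if d a ≤ 0 then f (c (pr (φ a))) else h (pr (d a))
  have hG : Continuous G := by
    refine Continuous.if_le (by fun_prop) (by fun_prop) (by fun_prop) continuous_const ?_
    intro a ha
    rw [ha, pr0 0 le_rfl]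
    refine hend _ ?_
    rcases max_choice (a.2 - 4 * a.1 : ℝ) (a.2 - 4 * (1 - a.1)) with hm | hm
    · have h1 : (a.2 - 4 * a.1 : ℝ) = 0 := hm.symm.trans ha
      exact Or.inl (pr0 _ (div_nonpos_of_nonpos_of_nonneg (by linarith) (hne a.2).le))
    · have h1 : (a.2 - 4 * (1 - a.1) : ℝ) = 0 := hm.symm.trans ha
      exact Or.inr (pr1 _ ((one_le_div (hne a.2)).2 (by linarith)))
  have hG1 : ∀ u : I, u = 0 ∨ u = 1 → ∀ t, G (u, t) = h t := by
    intro u hu t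
    have hd : d (u, t) = t := by
      rcases hu with rfl | rfl
      · simp only [d, Set.Icc.coe_zero]
        rw [max_eq_left (by linarith)]; ring
      · simp only [d, Set.Icc.coe_one]
        rw [max_eq_right (by linarith)]; ring
    by_cases ht : (t : ℝ) ≤ 0
    · have ht0 : t = 0 := le_antisymm ht t.2.1
      subst ht0
      simp only [G, hd, if_pos ht]
      refine hend _ ?_
      rcases hu with rfl | rfl
      · exact Or.inl (pr0 _ (by simp [φ]))
      · exact Or.inr (pr1 _ (by simp [φ]))
    · simp only [G, hd, if_neg ht, prI]
  have hG0 : ∀ u : I, G (u, 0) = f (c u) := by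
    intro u
    have hd : d (u, 0) ≤ 0 := max_le (by simpa using u.2.1) (by simpa using u.2.2)
    have hp : φ (u, 0) = u := by simp [φ]
    simp only [G, if_pos hd, hp, prI]
  -- Both ends of I are sent to the same path `h`, so the curried `G` descends to the circle.
  obtain ⟨F, F1, F2⟩ := hc.lift_prod (Q := Unit) (z := h)
    (fun a => (ContinuousMap.mk G hG).curry a.1) (by fun_prop)
    fun u hu _ => ContinuousMap.ext fun t => hG1 u hu t
  refine ⟨⟨fun a => F (a.1, ()) a.2, by fun_prop⟩, fun x => ?_, fun t => ?_⟩
  · obtain ⟨u, rfl⟩ := hc.isQuotientMap.surjective x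
    exact (congrArg (fun k : C(I, Z) => k 0) (F1 u ())).trans (hG0 u)
  · exact congrArg (fun k : C(I, Z) => k t) (F2 ())

theorem exists_isCollapse_suspension_circle :
    ∃ a : C(I^(Fin 2), Suspension (Sphere.base 1)),
      IsCollapse a (Cube.boundary (Fin 2)) (Suspension.base (Sphere.base 1)) := by
  obtain ⟨c, hc⟩ := exists_isCollapse_circle
  let b : C(I^(Fin 2), Sphere 1 × I) := ⟨fun t => (c (t 0), t 1), by fun_prop⟩
  have hb : Function.Surjective b := by
    rintro ⟨y, s⟩
    obtain ⟨u, rfl⟩ := hc.isQuotientMap.surjective y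
    exact ⟨![u, s], rfl⟩
  have hS := suspension_isCollapse (Sphere.base 1)
  have hbd : ∀ t : I^(Fin 2), b t ∈ {p : Sphere 1 × I | p.1 = Sphere.base 1 ∨ p.2 = 0 ∨ p.2 = 1} ↔
      t ∈ Cube.boundary (Fin 2) := by
    intro t
    change (c (t 0) = _ ∨ t 1 = 0 ∨ t 1 = 1) ↔ ∃ i, _
    rw [hc.eq_base_iff, Fin.exists_fin_two]
    rfl
  refine ⟨(Suspension.proj _).comp b, hS.isQuotientMap.comp
    (Topology.IsQuotientMap.of_surjective_continuous hb b.continuous), fun t => ?_, fun t t' h => ?_⟩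
  · exact (hS.eq_base_iff _).trans (hbd t)
  · rcases hS.eq_or_mem _ _ h with h | h
    · rcases hc.eq_or_mem _ _ (congrArg Prod.fst h) with h' | h'
      · refine Or.inl (funext fun i => ?_)
        fin_cases i
        · exact h'
        · exact congrArg Prod.snd h
      · exact Or.inr ⟨0, h'⟩
    · exact Or.inr ((hbd t).1 h)

/-- Both spaces are quotients of the square that collapse exactly its boundary, so the identity of
the square induces mutually inverse maps. -/
theorem splitsAsSpheres_suspension_circle :
    SplitsAsSpheres (Suspension.base (Sphere.base 1)) (fun _ : Fin 1 => 1) := by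
  obtain ⟨q, hq⟩ := exists_isCollapse_sphere 2
  obtain ⟨a, ha⟩ := exists_isCollapse_suspension_circle
  let s : ∀ _ : Fin 1, Sphere 2 := fun _ => Sphere.base 2
  obtain ⟨F, F1, F2⟩ := ha.lift_prod (Q := Unit) (z := Wedge.base s)
    (fun t => Wedge.inc s 0 (q t.1)) (by fun_prop) fun t ht _ => by
      rw [(hq.eq_base_iff t).2 ht]; exact Wedge.inc_base s 0
  obtain ⟨G, G1, G2⟩ := Wedge.lift_prod (s := s) (q := fun _ => q) (fun _ => hq) (Q := Unit)
    (z := Suspension.base (Sphere.base 1)) (fun _ t => a t.1) (fun _ => by fun_prop)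
    fun _ t ht _ => (ha.eq_base_iff t).2 ht
  let f : C(Suspension (Sphere.base 1), Wedge s) := ⟨fun x => F (x, ()), by fun_prop⟩
  let g : C(Wedge s, Suspension (Sphere.base 1)) := ⟨fun x => G (x, ()), by fun_prop⟩
  have hgf : g.comp f = ContinuousMap.id _ := by
    ext x
    obtain ⟨t, rfl⟩ := ha.isQuotientMap.surjective x
    exact (congrArg g (F1 t ())).trans (G1 0 t ())
  have hfg : f.comp g = ContinuousMap.id _ := by
    ext x
    rcases Wedge.eq_base_or_inc s x with rfl | ⟨r, y, rfl⟩
    · exact (congrArg f (G2 ())).trans (F2 ())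
    · obtain ⟨t, rfl⟩ := hq.isQuotientMap.surjective y
      obtain rfl : r = 0 := Subsingleton.elim _ _
      exact (congrArg f (G1 0 t ())).trans (F1 t ())
  refine ⟨f, g, F2 (), G2 (), ?_, ?_⟩
  · rw [hgf]; exact .refl _
  · rw [hfg]; exact .refl _

/-! ### The splitting of Gottlieb groups of mapping spaces -/

theorem nonempty_range_mulEquiv_of_splitsAsSpheres {X Z Z' : Type*} [TopologicalSpace X]
    [LocallyCompactSpace X] [T2Space X] [TopologicalSpace Z] [TopologicalSpace Z'] {x₀ : X}
    (hX : WellPointed x₀) {k : ℕ} {i : Fin k → ℕ}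
    (hi : SplitsAsSpheres (Suspension.base x₀) i) {z : Z} {z' : Z'} (μ : C(Z × Z, Z))
    (hl : ∀ b, μ (z, b) = b) (hr : ∀ b, μ (b, z) = b) (ω : C(Z, Z')) (hω : ω z = z') (n : ℕ)
    [NeZero n] :
    Nonempty ((inducedHom (Fin n) (postcomp X ω) (postcomp_const X ω hω)).range ≃*
      (inducedHom (Fin n) ω hω).range ×
        ∀ r, (inducedHom (Fin (n + i r)) ω hω).range) := by
  obtain ⟨f, g, hf, hg, hgf, hfg⟩ := hi
  choose q hq using fun r => exists_isCollapse_sphere (i r + 1)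
  have hn : n - 1 + 1 = n := Nat.succ_pred (NeZero.ne n)
  -- Of n coordinates one is spent on the suspension; the remaining n - 1 together with the i_r + 1
  -- of the sphere make n + i_r. Any bijections of the index sets will do.
  let e : Fin (n - 1) ⊕ Unit ≃ Fin n := Fintype.equivOfCardEq (by simp [hn])
  let e' : ∀ r, Fin (n - 1) ⊕ Fin (i r + 1) ≃ Fin (n + i r) := fun r =>
    Fintype.equivOfCardEq (by simp; omega)
  exact nonempty_range_mulEquiv f g hX e e' hq hf hg hgf hfg μ hl hr ω hω

section

variable {Y : Type*} [TopologicalSpace Y] [LocallyCompactSpace Y] [PathConnectedSpace Y] (y₀ : Y)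
  (n : ℕ) [NeZero n]

theorem nonempty_gottliebGroup_mulEquiv_of_splitsAsSpheres {X : Type*} [TopologicalSpace X]
    [LocallyCompactSpace X] [T2Space X] {x₀ : X} (hX : WellPointed x₀) {k : ℕ} {i : Fin k → ℕ}
    (hi : SplitsAsSpheres (Suspension.base x₀) i) :
    Nonempty (gottliebGroup n (NullMap X y₀) (NullMap.base X y₀) ≃*
      gottliebGroup n Y y₀ × ((r : Fin k) → gottliebGroup (n + i r) Y y₀)) := by
  obtain ⟨φ⟩ := nonempty_gottliebGroup_nullMap_mulEquiv (X := X) y₀ n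
  obtain ⟨ψ⟩ := nonempty_range_mulEquiv_of_splitsAsSpheres hX hi (z := ContinuousMap.id Y)
    (compMul Y) (fun _ => rfl) (fun _ => rfl) (evalAt Y y₀) (z' := y₀) rfl n
  rw [← gottliebGroup_eq_range] at ψ
  refine ⟨φ.trans (ψ.trans (MulEquiv.prodCongr (MulEquiv.refl _)
    (MulEquiv.piCongrRight fun r => MulEquiv.subgroupCongr ?_)))⟩
  exact (gottliebGroup_eq_range y₀ (n + i r)).symm

/-- The first case cannot be applied with `NullMap X'' y₀` in place of `Y`, since that space need
not be locally compact. Instead currying `X''` into the target, both for C(Y, Y) and for `Y`, leaves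
a splitting over `X'` whose factors are again Gottlieb groups of `NullMap X'' y₀`. -/
theorem nonempty_gottliebGroup_prod_mulEquiv_of_splitsAsSpheres {X' X'' : Type*}
    [TopologicalSpace X'] [LocallyCompactSpace X'] [T2Space X'] [TopologicalSpace X'']
    [LocallyCompactSpace X''] {x' : X'} (hX : WellPointed x') {k : ℕ} {i : Fin k → ℕ}
    (hi : SplitsAsSpheres (Suspension.base x') i) :
    Nonempty (gottliebGroup n (NullMap (X' × X'') y₀) (NullMap.base (X' × X'') y₀) ≃*
      gottliebGroup n (NullMap X'' y₀) (NullMap.base X'' y₀) ×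
        ((r : Fin k) → gottliebGroup (n + i r) (NullMap X'' y₀) (NullMap.base X'' y₀))) := by
  obtain ⟨φ⟩ := nonempty_gottliebGroup_nullMap_mulEquiv (X := X' × X'') y₀ n
  obtain ⟨χ⟩ := nonempty_range_mulEquiv_of_homeomorph (N := Fin n)
    (u := ContinuousMap.const (X' × X'') (ContinuousMap.id Y))
    (postcomp (X' × X'') (evalAt Y y₀)) (v := ContinuousMap.const (X' × X'') y₀) rfl
    (u' := ContinuousMap.const X' (ContinuousMap.const X'' (ContinuousMap.id Y)))
    (postcomp X' (postcomp X'' (evalAt Y y₀)))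
    (v' := ContinuousMap.const X' (ContinuousMap.const X'' y₀)) rfl
    Homeomorph.curry rfl Homeomorph.curry rfl (fun _ => rfl)
  obtain ⟨ψ⟩ := nonempty_range_mulEquiv_of_splitsAsSpheres hX hi
    (z := ContinuousMap.const X'' (ContinuousMap.id Y))
    (mapMul X'' (compMul Y)) (fun _ => rfl) (fun _ => rfl) (postcomp X'' (evalAt Y y₀))
    (z' := ContinuousMap.const X'' y₀) rfl n
  obtain ⟨α⟩ := nonempty_gottliebGroup_nullMap_mulEquiv (X := X'') y₀ n
  let β := fun r : Fin k =>
    (nonempty_gottliebGroup_nullMap_mulEquiv (X := X'') y₀ (n + i r)).some.symm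
  exact ⟨φ.trans (χ.trans (ψ.trans (MulEquiv.prodCongr α.symm (MulEquiv.piCongrRight β))))⟩

theorem nonempty_gottliebGroup_circle_mulEquiv :
    Nonempty (gottliebGroup n (NullMap (Sphere 1) y₀) (NullMap.base (Sphere 1) y₀) ≃*
      gottliebGroup n Y y₀ × gottliebGroup (n + 1) Y y₀) := by
  obtain ⟨φ⟩ := nonempty_gottliebGroup_mulEquiv_of_splitsAsSpheres y₀ n wellPointed_circle
    splitsAsSpheres_suspension_circle
  exact ⟨φ.trans (MulEquiv.prodCongr (MulEquiv.refl _)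
    (MulEquiv.piUnique fun _ : Fin 1 => gottliebGroup (n + 1) Y y₀))⟩

end

end Gottlieb

theorem mainTheorem3
    {Y : Type*} [TopologicalSpace Y] [LocallyCompactSpace Y] [T2Space Y] [PathConnectedSpace Y]
    (y₀ : Y) (_hY : Gottlieb.WellPointed y₀) (n : ℕ) [NeZero n] :
    (∀ (X : Type*) [TopologicalSpace X] [LocallyCompactSpace X] [T2Space X] [ConnectedSpace X]
        (x₀ : X), Gottlieb.WellPointed x₀ →
        ∀ (k : ℕ) (i : Fin k → ℕ),
          Gottlieb.SplitsAsSpheres (Gottlieb.Suspension.base x₀) i →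
          Nonempty
            (Gottlieb.gottliebGroup n (Gottlieb.NullMap X y₀) (Gottlieb.NullMap.base X y₀) ≃*
              Gottlieb.gottliebGroup n Y y₀ ×
                ((r : Fin k) → Gottlieb.gottliebGroup (n + i r) Y y₀))) ∧
    (∀ (X' : Type*) [TopologicalSpace X'] [LocallyCompactSpace X'] [T2Space X']
        [ConnectedSpace X'] (x' : X') (X'' : Type*) [TopologicalSpace X'']
        [LocallyCompactSpace X''] [T2Space X''] [ConnectedSpace X''] (x'' : X''),
        Gottlieb.WellPointed x' → Gottlieb.WellPointed x'' →
        ∀ (k : ℕ) (i : Fin k → ℕ),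
          Gottlieb.SplitsAsSpheres (Gottlieb.Suspension.base x') i →
          Nonempty
            (Gottlieb.gottliebGroup n (Gottlieb.NullMap (X' × X'') y₀)
                (Gottlieb.NullMap.base (X' × X'') y₀) ≃*
              Gottlieb.gottliebGroup n (Gottlieb.NullMap X'' y₀) (Gottlieb.NullMap.base X'' y₀) ×
                ((r : Fin k) → Gottlieb.gottliebGroup (n + i r) (Gottlieb.NullMap X'' y₀)
                  (Gottlieb.NullMap.base X'' y₀)))) ∧
    Nonempty
      (Gottlieb.gottliebGroup n (Gottlieb.NullMap (Gottlieb.Sphere 1) y₀)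
          (Gottlieb.NullMap.base (Gottlieb.Sphere 1) y₀) ≃*
        Gottlieb.gottliebGroup n Y y₀ × Gottlieb.gottliebGroup (n + 1) Y y₀) := by
  refine ⟨?_, ?_, Gottlieb.nonempty_gottliebGroup_circle_mulEquiv y₀ n⟩
  · intro X _ _ _ _ x₀ hX k i hi
    exact Gottlieb.nonempty_gottliebGroup_mulEquiv_of_splitsAsSpheres y₀ n hX hi
  · intro X' _ _ _ _ x' X'' _ _ _ _ x'' hX' _ k i hi
    exact Gottlieb.nonempty_gottliebGroup_prod_mulEquiv_of_splitsAsSpheres y₀ n hX' hi
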